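/- Let $d\ge 1$, $\lambda>0$, and for $n\ge 1$ let $\mathbb T_n^d=\mathbb Z^d/n\mathbb Z^d$ be the discrete torus, with unit vectors $e_1,\dots,e_d$. For a configuration $\eta\in\{0,1\}^{\mathbb T_n^d}$ put $c_x^-(\eta)=1$, $c_x^+(\eta)=1+\lambda\sum_{j=1}^d\eta_{x-e_j}\eta_{x+e_j}$ and $c_x(\eta)=\eta_xc_x^-(\eta)+(1-\eta_x)c_x^+(\eta)$. The reaction–diffusion process $(\eta^n_t)_{t\ge0}$ is the Markov process on $\{0,1\}^{\mathbb T_n^d}$ with generator $$L_nf(\eta)=n^2\sum_{x\in\mathbb T_n^d}\sum_{j=1}^d[f(\eta^{x,x+e_j})-f(\eta)]+\sum_{x\in\mathbb T_n^d}c_x(\eta)[f(\eta^x)-f(\eta)],$$ where $\eta^{x,y}$ is $\eta$ with the values at $x$ and $y$ exchanged and $\eta^x$ is $\eta$ flipped at $x$. Let $\nu_m$ denote the product Bernoulli measure of parameter $m$, and let $$F(m)=\int\{(1-\eta_0)c_0^+(\eta)-\eta_0c_0^-(\eta)\}\,\mathrm d\nu_m,$$ the integral being over $\{0,1\}^{\mathbb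 Z^d}$. For a probability measure $\mu$ on $\{0,1\}^{\mathbb T_n^d}$ let $H(\mu|\nu_m)=\sum_\eta\frac{\mu(\eta)}{\nu_m(\eta)}\log\frac{\mu(\eta)}{\nu_m(\eta)}\,\nu_m(\eta)$ be the relative entropy. Let $g_d(n)=n$ for $d=1$, $g_d(n)=\log n$ for $d=2$ and $g_d(n)=1$ for $d\ge3$. Theorem (Entropy Estimate). Let $\rho\in(0,1)$ satisfy $F(\rho)=0$, and let $T>0$ and $K\ge0$. There is a constant $C>0$, depending only on $d,\lambda,\rho,T,K$, such that the following holds for every $n\ge1$ (every $n\ge2$ if $d=2$). Let $\mu_t$ be the law of $\eta^n_t$. (i) If the initial law satisfies $H(\mu_0|\nu_\rho)\le K\,n^{d-2}g_d(n)$ (for instance, if $\mu_0=\nu_\rho$), then for every $t\in(0,T]$ the function $t\mapsto H(\mu_t|\nu_\rho)$ is differentiable at $t$ and $$\partial_tH(\mu_t|\nu_\rho)\le C\,n^{d-2}g_d(n).$$ (ii) In particular, if $\mu_0=\nu_\rho$, then $H(\mu_t|\nu_\rho)\le C\,t\,n^{d-2}g_d(n)$ for every $t\in[0,T]$. -/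

import Mathlib

open MeasureTheory

noncomputable section

namespace ReactionDiffusion

/-- Particle configurations on the set of sites `V`: `η x = true` iff `x` is occupied. -/
abbrev Config (V : Type*) := V → Bool

/-- The occupation number `η_x ∈ {0, 1}` as a real number. -/
def occ {V : Type*} (η : Config V) (x : V) : ℝ := if η x then 1 else 0

/-- The `d`-dimensional discrete torus `ℤ^d / nℤ^d`. -/
abbrev Torus (d n : ℕ) := Fin d → ZMod n

/-- The unit vector `e_j`, in `ℤ^d` (`R = ℤ`) or in the discrete torus (`R = ZMod n`). -/
def unitVec {R : Type*} [CommRing R] {d : ℕ} (j : Fin d) : Fin d → R := Pi.single j 1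

/-- The death rate `c_x^-(η) = 1`. -/
def deathRate {R : Type*} {d : ℕ} (_η : Config (Fin d → R)) (_x : Fin d → R) : ℝ := 1

/-- The birth rate `c_x^+(η) = 1 + lam * ∑_j η_{x - e_j} η_{x + e_j}`. -/
def birthRate {R : Type*} [CommRing R] {d : ℕ} (lam : ℝ) (η : Config (Fin d → R))
    (x : Fin d → R) : ℝ :=
  1 + lam * ∑ j : Fin d, occ η (x - unitVec j) * occ η (x + unitVec j)

/-- The flip rate `c_x(η) = η_x c_x^-(η) + (1 - η_x) c_x^+(η)`. -/
def flipRate {R : Type*} [CommRing R] {d : ℕ} (lam : ℝ) (η : Config (Fin d → R))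
    (x : Fin d → R) : ℝ :=
  occ η x * deathRate η x + (1 - occ η x) * birthRate lam η x

/-- `η^x`: the configuration `η` flipped at `x`. -/
def flip {V : Type*} [DecidableEq V] (η : Config V) (x : V) : Config V :=
  Function.update η x (!(η x))

/-- `η^{x,y}`: the configuration `η` with the values at `x` and `y` exchanged. -/
def exchange {V : Type*} [DecidableEq V] (η : Config V) (x y : V) : Config V :=
  fun z => η (Equiv.swap x y z)

/-- The generator `L^{ex}` of the symmetric simple exclusion process on the torus. -/
def exclusionGenerator (d n : ℕ) [NeZero n] (f : Config (Torus d n) → ℝ)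
    (η : Config (Torus d n)) : ℝ :=
  ∑ x : Torus d n, ∑ j : Fin d, (f (exchange η x (x + unitVec j)) - f η)

/-- The generator `L^r` of the birth-and-death dynamics on the torus. -/
def reactionGenerator (d n : ℕ) [NeZero n] (lam : ℝ) (f : Config (Torus d n) → ℝ)
    (η : Config (Torus d n)) : ℝ :=
  ∑ x : Torus d n, flipRate lam η x * (f (flip η x) - f η)

/-- The generator `L_n = n^2 L^{ex} + L^r` of the reaction-diffusion process. -/
def generator (d n : ℕ) [NeZero n] (lam : ℝ) (f : Config (Torus d n) → ℝ)
    (η : Config (Torus d n)) : ℝ :=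
  (n : ℝ) ^ 2 * exclusionGenerator d n f η + reactionGenerator d n lam f η

/-- The matrix of an operator `L` on real functions on a finite set `S`;
the entry at `(x, y)` with `x ≠ y` is the jump rate from `x` to `y` if `L` is a generator. -/
def generatorMatrix {S : Type*} [DecidableEq S] (L : (S → ℝ) → S → ℝ) : Matrix S S ℝ :=
  Matrix.of fun x y => L (Pi.single y 1) x

/-- The transition probability `p_t(x, y) = (e^{tL})(x, y)`. -/
def transition {S : Type*} [Fintype S] [DecidableEq S] (L : (S → ℝ) → S → ℝ) (t : ℝ)
    (x y : S) : ℝ :=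
  NormedSpace.exp (t • generatorMatrix L) x y

/-- `(X t)_{t ≥ 0}` is, under `P`, a time-homogeneous Markov process on the finite set `S` with
infinitesimal generator `L`, expressed by the finite-dimensional distributions. Only the times
`t ≥ 0` matter; the initial law is arbitrary. -/
structure IsMarkovProcess {S : Type*} [Fintype S] [DecidableEq S] [MeasurableSpace S]
    {Ω : Type*} [MeasurableSpace Ω] (L : (S → ℝ) → S → ℝ) (P : Measure Ω)
    (X : ℝ → Ω → S) : Prop where
  measurable : ∀ t, 0 ≤ t → Measurable (X t)
  finDimDistr : ∀ (k : ℕ) (t : Fin (k + 1) → ℝ), 0 ≤ t 0 → Monotone t →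
    ∀ s : Fin (k + 1) → S,
      P.real {ω | ∀ i, X (t i) ω = s i} =
        P.real {ω | X (t 0) ω = s 0} *
          ∏ i : Fin k, transition L (t i.succ - t i.castSucc) (s i.castSucc) (s i.succ)

/-- The product measure `ν_m` on configurations: independent Bernoulli variables of parameter `m`,
on a finite or infinite set of sites. -/
def bernoulliProduct (V : Type*) (m : unitInterval) : Measure (Config V) :=
  Measure.infinitePi fun _ : V => ProbabilityTheory.bernoulliMeasure true false m

/-- The forcing term `F(m) = ∫ {(1 - η_0) c_0^+(η) - η_0 c_0^-(η)} dν_m` of the hydrodynamic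
equation, `ν_m` being the Bernoulli product measure on `{0,1}^{ℤ^d}`. -/
def forcing (d : ℕ) (lam : ℝ) (m : unitInterval) : ℝ :=
  ∫ η : Config (Fin d → ℤ),
    ((1 - occ η 0) * birthRate lam η 0 - occ η 0 * deathRate η 0)
      ∂(bernoulliProduct (Fin d → ℤ) m)

/-- The relative entropy `H(μ|ν) = ∑_x (μ(x)/ν(x)) log (μ(x)/ν(x)) ν(x)` on a finite set, for
`ν` charging every point. -/
def relEntropy {S : Type*} [Fintype S] [MeasurableSpace S] (μ ν : Measure S) : ℝ :=
  ∑ x : S, (μ.real {x} / ν.real {x}) * Real.log (μ.real {x} / ν.real {x}) * ν.real {x}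

/-- The relative entropy `H(μ_t|ν_m)`, where `μ_t` is the law of `X t`. -/
def entropyAt {d n : ℕ} [NeZero n] {Ω : Type*} [MeasurableSpace Ω] (P : Measure Ω)
    (X : ℝ → Ω → Config (Torus d n)) (m : unitInterval) (t : ℝ) : ℝ :=
  relEntropy (P.map (X t)) (bernoulliProduct (Torus d n) m)

/-- `g_d(n)`, equal to `n`, `log n`, `1` for `d = 1`, `d = 2`, `d ≥ 3`. -/
def gRate (d n : ℕ) : ℝ := if d = 1 then (n : ℝ) else if d = 2 then Real.log n else 1

/-- `n^{d-2} g_d(n)`, with a possibly negative exponent. -/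
def entropyScale (d n : ℕ) : ℝ := (n : ℝ) ^ ((d : ℤ) - 2) * gRate d n

end ReactionDiffusion

end

/-! Write f for the density of μ_t with respect to ν_ρ, H for its entropy, D for the exclusion
Dirichlet form at √f, and η̄ for the centred occupation numbers. The inequality a (log b − log a) ≤
b − a − (√b − √a)² and the exchange invariance of ν_ρ give ∂_t H ≤ −n² D + ∫ L^r f dν_ρ
(`bexp_mul_generator_log_le`). In the adjoint of L^r applied to 1, the part of degree one is a
multiple of F(ρ) = 0. What remains are the correlation sums ∑_x η̄_x η̄_{x+e_j} and ∑_x η̄_{x−e_j}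
η̄_x η̄_{x+e_j} (`bexp_reactionGenerator_eq`), both of the form ∑_x ω_x η̄_{x+e_j} with ω_x read at
or behind x.

Such a sum is bounded by ε n² D + C (H + n^{d−2} g_d(n)) at two scales. A flow carries the unit mass
at the origin to p ∗ p, where p is uniform on a box of side ℓ = 2^M (`exists_flow`). Summation by
parts turns the sum into a product of two box averages, plus gradients η̄_{u} − η̄_{u+e_i} weighted
by sums of ω along the flow. The weights do not read the two sites of the gradient, so an exchange
of these sites trades each gradient for the Dirichlet form and the square of the weight
(`bexp_mul_sub_mul_le`).

All squares are handled by the entropy inequality (`sum_bexp_sq_pattern_le`): the torus is coloured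
so that blocks of one colour are disjoint, a square in the exponent is linearised by a Gaussian
variable, and the sites are then integrated out one by one. The price is the ℓ² energy, which is
ℓ^{−d} for p and ∑_{m<M} 2^{m(2−d)} = O(g_d(n)) for the flow. The choice ℓ^d g_d(n) ≈ n² balances
the two.

Half of n² D absorbs the Dirichlet terms, so ∂_t H ≤ C (H + n^{d−2} g_d(n)), and Grönwall's
inequality concludes. Differentiating H requires f > 0 at positive times, which holds because every
site flips at rate at least 1 (`lawAt_pos`). -/

open MeasureTheory

noncomputable section

namespace ReactionDiffusion

/-! ### Bernoulli product measures: exponential moments and the entropy inequality -/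

section Bernoulli

set_option linter.unusedSectionVars false

variable {V : Type*} [Fintype V] [DecidableEq V]

/-- The mass that the Bernoulli product measure of parameter `r` gives to `η`. -/
def bweight (r : ℝ) (η : Config V) : ℝ := ∏ x, if η x then r else 1 - r

/-- The expectation of `g` under the Bernoulli product measure of parameter `r`. -/
def bexp (r : ℝ) (g : Config V → ℝ) : ℝ := ∑ η, bweight r η * g η

/-- The centred occupation number. -/
def cocc {V : Type*} (r : ℝ) (η : Config V) (x : V) : ℝ := occ η x - r

/-- `g` does not depend on the value of the configuration at `x`. -/
def FreeAt {V : Type*} [DecidableEq V] (g : Config V → ℝ) (x : V) : Prop :=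
  ∀ η b, g (Function.update η x b) = g η

theorem bweight_pos {r : ℝ} (h0 : 0 < r) (h1 : r < 1) (η : Config V) : 0 < bweight r η := by
  refine Finset.prod_pos fun x _ => ?_
  split_ifs <;> linarith

theorem bweight_update (r : ℝ) (η : Config V) (x : V) (b : Bool) :
    bweight r (Function.update η x b) =
      (if b then r else 1 - r) * ∏ y ∈ Finset.univ.erase x, if η y then r else 1 - r := by
  unfold bweight
  rw [← Finset.mul_prod_erase _ _ (Finset.mem_univ x)]
  congr 1
  · simp
  · refine Finset.prod_congr rfl fun y hy => ?_
    rw [Function.update_of_ne (Finset.ne_of_mem_erase hy)]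

theorem flip_flip (η : Config V) (x : V) : flip (flip η x) x = η := by
  ext y
  by_cases h : y = x
  · subst h; simp [flip]
  · simp [flip, h]

theorem sum_flip (x : V) (F : Config V → ℝ) : ∑ η, F (flip η x) = ∑ η, F η :=
  Equiv.sum_comp (Function.Involutive.toPerm (fun η : Config V => flip η x)
    (fun η => flip_flip η x)) F

theorem bexp_resample (r : ℝ) (x : V) (g : Config V → ℝ) :
    bexp r g = bexp r fun η => r * g (Function.update η x true)
      + (1 - r) * g (Function.update η x false) := by
  have h1 := sum_flip x fun η => bweight r η * g η
  have h2 := sum_flip x fun η => bweight r η * (r * g (Function.update η x true)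
      + (1 - r) * g (Function.update η x false))
  -- The identity fails termwise but holds for the sum over each pair {η, η^x}; both sides are
  -- therefore symmetrised under the flip at x.
  have key : ∑ η : Config V, (bweight r η * g η + bweight r (flip η x) * g (flip η x)) =
      ∑ η : Config V, (bweight r η * (r * g (Function.update η x true)
      + (1 - r) * g (Function.update η x false)) +
      bweight r (flip η x) * (r * g (Function.update (flip η x) x true)
      + (1 - r) * g (Function.update (flip η x) x false))) := by
    refine Finset.sum_congr rfl fun η _ => ?_
    have e : ∀ b, Function.update (flip η x) x b = Function.update η x b := fun b => by
      simp [flip]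
    have ht := bweight_update r η x true
    have hf := bweight_update r η x false
    rw [e, e]
    cases hx : η x
    · have a1 : Function.update η x false = η := by rw [← hx]; simp
      have a2 : flip η x = Function.update η x true := by simp [flip, hx]
      rw [a1] at hf
      rw [a2, a1, ht, hf]; simp; ring
    · have a1 : Function.update η x true = η := by rw [← hx]; simp
      have a2 : flip η x = Function.update η x false := by simp [flip, hx]
      rw [a1] at ht
      rw [a2, a1, ht, hf]; simp; ring
  rw [Finset.sum_add_distrib, Finset.sum_add_distrib, h1, h2] at key
  unfold bexp
  linarith

theorem bexp_mono {r : ℝ} (h0 : 0 < r) (h1 : r < 1) {g h : Config V → ℝ} (H : ∀ η, g η ≤ h η) :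
    bexp r g ≤ bexp r h :=
  Finset.sum_le_sum fun η _ => mul_le_mul_of_nonneg_left (H η) (bweight_pos h0 h1 η).le

theorem bexp_nonneg {r : ℝ} (h0 : 0 < r) (h1 : r < 1) {g : Config V → ℝ} (H : ∀ η, 0 ≤ g η) :
    0 ≤ bexp r g :=
  Finset.sum_nonneg fun η _ => mul_nonneg (bweight_pos h0 h1 η).le (H η)

theorem bexp_add (r : ℝ) (g h : Config V → ℝ) :
    bexp r (fun η => g η + h η) = bexp r g + bexp r h := by
  simp [bexp, mul_add, Finset.sum_add_distrib]

theorem bexp_const_mul (r c : ℝ) (g : Config V → ℝ) :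
    bexp r (fun η => c * g η) = c * bexp r g := by
  simp only [bexp, Finset.mul_sum]
  exact Finset.sum_congr rfl fun _ _ => by ring

theorem bexp_sum {ι : Type*} (r : ℝ) (s : Finset ι) (g : ι → Config V → ℝ) :
    bexp r (fun η => ∑ i ∈ s, g i η) = ∑ i ∈ s, bexp r (g i) := by
  simp only [bexp, Finset.mul_sum]
  exact Finset.sum_comm

theorem sum_bweight (r : ℝ) : ∑ η : Config V, bweight r η = 1 := by
  unfold bweight
  rw [← Fintype.prod_sum (fun (_ : V) (b : Bool) => if b then r else 1 - r)]
  simp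

theorem bexp_const (r c : ℝ) : bexp r (fun _ : Config V => c) = c := by
  simp [bexp, ← Finset.sum_mul, sum_bweight]

theorem abs_cocc_le {r : ℝ} (h0 : 0 < r) (h1 : r < 1) (η : Config V) (x : V) :
    |cocc r η x| ≤ 1 := by
  unfold cocc occ
  rw [abs_le]
  split_ifs <;> constructor <;> linarith

theorem FreeAt.mul {g h : Config V → ℝ} {x : V} (hg : FreeAt g x) (hh : FreeAt h x) :
    FreeAt (fun η => g η * h η) x := fun η b => by simp only [hg η b, hh η b]

theorem FreeAt.comp {g : Config V → ℝ} {x : V} (hg : FreeAt g x) (F : ℝ → ℝ) :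
    FreeAt (fun η => F (g η)) x := fun η b => by simp only [hg η b]

theorem FreeAt.sum {ι : Type*} {s : Finset ι} {g : ι → Config V → ℝ} {x : V}
    (hg : ∀ i ∈ s, FreeAt (g i) x) : FreeAt (fun η => ∑ i ∈ s, g i η) x :=
  fun η b => Finset.sum_congr rfl fun i hi => hg i hi η b

theorem freeAt_cocc (r : ℝ) {x y : V} (h : x ≠ y) : FreeAt (fun η => cocc r η x) y :=
  fun η b => by simp [cocc, occ, h]

theorem freeAt_const (c : ℝ) (x : V) : FreeAt (fun _ : Config V => c) x := fun _ _ => rfl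

/-- By convexity, the exponential lies below its chord over [−c, c]. -/
theorem exp_mul_le_cosh_add {c y : ℝ} (hy : |y| ≤ 1) :
    Real.exp (c * y) ≤ Real.cosh c + y * Real.sinh c := by
  rw [abs_le] at hy
  have := convexOn_exp.2 (Set.mem_univ c) (Set.mem_univ (-c))
    (by linarith : 0 ≤ (1 + y) / 2) (by linarith : 0 ≤ (1 - y) / 2) (by ring)
  simp only [smul_eq_mul] at this
  rw [Real.cosh_eq, Real.sinh_eq]
  calc Real.exp (c * y) = Real.exp ((1 + y) / 2 * c + (1 - y) / 2 * -c) := by congr 1; ring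
    _ ≤ _ := this
    _ = _ := by ring

/-- Conditional Hoeffding bound. Given the other sites, the centred variable at x has mean zero, so
the sinh part of the chord bound averages out, and cosh c ≤ exp (c² / 2). -/
theorem bexp_exp_mul_le {r : ℝ} (h0 : 0 < r) (h1 : r < 1) (x : V) {c R : Config V → ℝ} {B : ℝ}
    (hc : FreeAt c x) (hcB : ∀ η, |c η| ≤ B) (hR : FreeAt R x) (hR0 : ∀ η, 0 ≤ R η) :
    bexp r (fun η => Real.exp (c η * cocc r η x) * R η) ≤ Real.exp (B ^ 2 / 2) * bexp r R := by
  have step : bexp r (fun η => Real.exp (c η * cocc r η x) * R η) ≤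
      bexp r (fun η => (Real.cosh (c η) + cocc r η x * Real.sinh (c η)) * R η) :=
    bexp_mono h0 h1 fun η => mul_le_mul_of_nonneg_right
      (exp_mul_le_cosh_add (abs_cocc_le h0 h1 η x)) (hR0 η)
  refine step.trans ?_
  rw [bexp_resample r x, ← bexp_const_mul]
  refine bexp_mono h0 h1 fun η => ?_
  simp only [hc η, hR η, cocc, occ, Function.update_self]
  have hle : Real.cosh (c η) ≤ Real.exp (B ^ 2 / 2) := by
    refine (Real.cosh_le_exp_half_sq _).trans (Real.exp_le_exp.2 ?_)
    have := sq_le_sq' (abs_le.1 (hcB η)).1 (abs_le.1 (hcB η)).2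
    linarith
  calc _ = Real.cosh (c η) * R η := by simp; ring
    _ ≤ _ := mul_le_mul_of_nonneg_right hle (hR0 η)

/-- A martingale-type exponential bound: the sites are integrated out in increasing order of their
rank, and `R` is left untouched. -/
theorem bexp_exp_sum_mul_le {ι : Type*} [DecidableEq ι] {r : ℝ} (h0 : 0 < r) (h1 : r < 1)
    (rank : ι → ℕ) (site : ι → V) (c : ι → Config V → ℝ) (B : ι → ℝ) (R : Config V → ℝ)
    (hR0 : ∀ η, 0 ≤ R η) (A : Finset ι)
    (hsite : ∀ y ∈ A, ∀ y' ∈ A, site y = site y' → y = y')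
    (hc : ∀ y ∈ A, ∀ y' ∈ A, rank y' ≤ rank y → FreeAt (c y) (site y'))
    (hcB : ∀ y ∈ A, ∀ η, |c y η| ≤ B y) (hR : ∀ y ∈ A, FreeAt R (site y)) :
    bexp r (fun η => Real.exp (∑ y ∈ A, c y η * cocc r η (site y)) * R η) ≤
      Real.exp ((∑ y ∈ A, B y ^ 2) / 2) * bexp r R := by
  induction A using Finset.induction_on_min_value rank with
  | empty => simp
  | insert a s ha hmin ih =>
    have hs := fun y (hy : y ∈ s) => Finset.mem_insert_of_mem (b := a) hy
    have haA := Finset.mem_insert_self a s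
    have ih' := ih (fun y hy y' hy' => hsite y (hs y hy) y' (hs y' hy'))
      (fun y hy y' hy' => hc y (hs y hy) y' (hs y' hy')) (fun y hy => hcB y (hs y hy))
      (fun y hy => hR y (hs y hy))
    -- The new index `a` has minimal rank, so its site enters no coefficient of `s`. The coefficient
    -- of `a` may still depend on sites of higher rank, which is why `a` must be integrated first.
    have hfree : FreeAt (fun η => Real.exp (∑ y ∈ s, c y η * cocc r η (site y)) * R η) (site a) := by
      refine FreeAt.mul (FreeAt.comp (FreeAt.sum fun y hy => ?_) Real.exp) (hR a haA)
      refine FreeAt.mul (hc y (hs y hy) a haA (hmin y hy)) (freeAt_cocc r fun h => ha ?_)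
      rwa [← hsite y (hs y hy) a haA h]
    have := bexp_exp_mul_le h0 h1 (site a) (hc a haA a haA le_rfl) (hcB a haA) hfree
      (fun η => mul_nonneg (Real.exp_pos _).le (hR0 η))
    simp only [Finset.sum_insert ha]
    calc _ = bexp r (fun η => Real.exp (c a η * cocc r η (site a)) *
          (Real.exp (∑ y ∈ s, c y η * cocc r η (site y)) * R η)) := by
            congr 1; ext η; rw [Real.exp_add]; ring
      _ ≤ _ := this
      _ ≤ Real.exp (B a ^ 2 / 2) * (Real.exp ((∑ y ∈ s, B y ^ 2) / 2) * bexp r R) := by gcongr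
      _ = _ := by rw [← mul_assoc, ← Real.exp_add]; congr 2; ring

theorem integral_exp_mul_gaussian (u : ℝ) :
    ∫ g, Real.exp (u * g) ∂(ProbabilityTheory.gaussianReal 0 1) = Real.exp (u ^ 2 / 2) := by
  have := congrFun (ProbabilityTheory.mgf_id_gaussianReal (μ := 0) (v := 1)) u
  simpa [ProbabilityTheory.mgf] using this

/-- The integral equals √2; the bound 2 becomes the factor lost per block below. -/
theorem integral_exp_sq_gaussian_le :
    Integrable (fun g : ℝ => Real.exp (g ^ 2 / 4)) (ProbabilityTheory.gaussianReal 0 1) ∧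
    ∫ g, Real.exp (g ^ 2 / 4) ∂(ProbabilityTheory.gaussianReal 0 1) ≤ 2 := by
  have hv : (1 : NNReal) ≠ 0 := one_ne_zero
  have e : ∀ x : ℝ, ProbabilityTheory.gaussianPDFReal 0 1 x * Real.exp (x ^ 2 / 4) =
      (√(2 * Real.pi))⁻¹ * Real.exp (-(1 / 4) * x ^ 2) := fun x => by
    simp only [ProbabilityTheory.gaussianPDFReal]
    rw [mul_assoc, ← Real.exp_add]
    simp only [NNReal.coe_one, mul_one, sub_zero]
    congr 2; ring
  constructor
  · rw [ProbabilityTheory.gaussianReal_of_var_ne_zero _ hv,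
      integrable_withDensity_iff_integrable_smul' (by fun_prop)
        (by simp [ProbabilityTheory.gaussianPDF])]
    simp only [ProbabilityTheory.toReal_gaussianPDF, smul_eq_mul, e]
    exact (integrable_exp_neg_mul_sq (by norm_num)).const_mul _
  · rw [ProbabilityTheory.integral_gaussianReal_eq_integral_smul hv]
    simp only [smul_eq_mul, e]
    rw [integral_const_mul, integral_gaussian, ← Real.sqrt_inv, ← Real.sqrt_mul (by positivity)]
    rw [Real.sqrt_le_left (by norm_num)]
    have := Real.pi_pos
    field_simp
    norm_num

/-- Integrating out one quadratic exponential. -/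
theorem bexp_exp_sq_mul_le {ι : Type*} [DecidableEq ι] {r : ℝ} (h0 : 0 < r) (h1 : r < 1)
    (rank : ι → ℕ) (site : ι → V) (a : ι → ℝ) (κ : ι → Config V → ℝ) (R : Config V → ℝ)
    (hR0 : ∀ η, 0 ≤ R η) (A : Finset ι) {s : ℝ} (hs : 0 < s) (ha : ∑ y ∈ A, a y ^ 2 ≤ s)
    (hsite : ∀ y ∈ A, ∀ y' ∈ A, site y = site y' → y = y')
    (hκ : ∀ y ∈ A, ∀ y' ∈ A, rank y' ≤ rank y → FreeAt (κ y) (site y'))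
    (hκ1 : ∀ y ∈ A, ∀ η, |κ y η| ≤ 1) (hR : ∀ y ∈ A, FreeAt R (site y)) :
    bexp r (fun η => Real.exp ((4 * s)⁻¹ * (∑ y ∈ A, a y * κ y η * cocc r η (site y)) ^ 2) * R η) ≤
      2 * bexp r R := by
  set h : Config V → ℝ := fun η => ∑ y ∈ A, a y * κ y η * cocc r η (site y) with hh
  set q : ℝ := (√(2 * s))⁻¹ with hq
  have hq2 : q ^ 2 = (2 * s)⁻¹ := by rw [hq, inv_pow, Real.sq_sqrt (by positivity)]
  -- Gaussian linearisation: the square in the exponent becomes a linear term with random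
  -- coefficient q g, where q² / 2 = 1 / (4 s).
  have e1 : ∀ η, Real.exp ((4 * s)⁻¹ * h η ^ 2) =
      ∫ g, Real.exp (q * h η * g) ∂(ProbabilityTheory.gaussianReal 0 1) := fun η => by
    rw [integral_exp_mul_gaussian, mul_pow, hq2]
    congr 1; field_simp; ring
  have hint : ∀ u : ℝ, Integrable (fun g : ℝ => Real.exp (u * g))
      (ProbabilityTheory.gaussianReal 0 1) := fun u =>
    ProbabilityTheory.integrable_exp_mul_gaussianReal u
  have e2 : bexp r (fun η => Real.exp ((4 * s)⁻¹ * h η ^ 2) * R η) =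
      ∫ g, bexp r (fun η => Real.exp (q * h η * g) * R η)
        ∂(ProbabilityTheory.gaussianReal 0 1) := by
    unfold bexp
    rw [integral_finsetSum]
    · refine Finset.sum_congr rfl fun η _ => ?_
      rw [integral_const_mul, integral_mul_const, ← e1]
    · intro η _
      exact ((hint _).mul_const _).const_mul _
  change bexp r (fun η => Real.exp ((4 * s)⁻¹ * h η ^ 2) * R η) ≤ _
  rw [e2]
  have hRn : 0 ≤ bexp r R := bexp_nonneg h0 h1 hR0
  -- For fixed g the variance proxy is at most q² g² s = g² / 2, hence the exponent g² / 4, still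
  -- integrable against the Gaussian.
  have bound : ∀ g : ℝ, bexp r (fun η => Real.exp (q * h η * g) * R η) ≤
      Real.exp (g ^ 2 / 4) * bexp r R := fun g => by
    have := bexp_exp_sum_mul_le h0 h1 rank site (fun y η => q * g * a y * κ y η)
      (fun y => |q * g * a y|) R hR0 A hsite
      (fun y hy y' hy' hle => FreeAt.mul (freeAt_const _ _) (hκ y hy y' hy' hle))
      (fun y hy η => by
        rw [abs_mul]
        exact mul_le_of_le_one_right (abs_nonneg _) (hκ1 y hy η)) hR
    calc _ = bexp r (fun η => Real.exp (∑ y ∈ A, q * g * a y * κ y η * cocc r η (site y)) * R η) := by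
          congr 1; ext η; congr 2
          rw [hh, Finset.mul_sum, Finset.sum_mul]
          exact Finset.sum_congr rfl fun _ _ => by ring
      _ ≤ _ := this
      _ ≤ _ := by
        refine mul_le_mul_of_nonneg_right (Real.exp_le_exp.2 ?_) hRn
        have : ∑ y ∈ A, |q * g * a y| ^ 2 = (2 * s)⁻¹ * g ^ 2 * ∑ y ∈ A, a y ^ 2 := by
          rw [Finset.mul_sum]
          refine Finset.sum_congr rfl fun y _ => ?_
          rw [sq_abs, ← hq2]; ring
        rw [this]
        have h2 : (2 * s)⁻¹ * g ^ 2 * ∑ y ∈ A, a y ^ 2 ≤ (2 * s)⁻¹ * g ^ 2 * s := by gcongr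
        have h3 : (2 * s)⁻¹ * g ^ 2 * s = g ^ 2 / 2 := by field_simp
        linarith
  have hI := integral_exp_sq_gaussian_le
  calc _ ≤ ∫ g, Real.exp (g ^ 2 / 4) * bexp r R ∂(ProbabilityTheory.gaussianReal 0 1) := by
        refine integral_mono ?_ (hI.1.mul_const _) bound
        unfold bexp
        refine integrable_finsetSum _ fun η _ => ?_
        exact ((hint _).mul_const _).const_mul _
    _ = (∫ g, Real.exp (g ^ 2 / 4) ∂(ProbabilityTheory.gaussianReal 0 1)) * bexp r R :=
        integral_mul_const _ _
    _ ≤ _ := mul_le_mul_of_nonneg_right hI.2 hRn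

/-- Exponential moment of a sum of squares over a separated family. -/
theorem bexp_exp_sum_sq_le {ι Z : Type*} [DecidableEq ι] [DecidableEq Z] {r : ℝ}
    (h0 : 0 < r) (h1 : r < 1)
    (rank : ι → ℕ) (site : Z → ι → V) (a : ι → ℝ) (κ : Z → ι → Config V → ℝ)
    (A : Finset ι) {s : ℝ} (hs : 0 < s) (ha : ∑ y ∈ A, a y ^ 2 ≤ s)
    (hsite : ∀ z, ∀ y ∈ A, ∀ y' ∈ A, site z y = site z y' → y = y')
    (hκ : ∀ z, ∀ y ∈ A, ∀ y' ∈ A, rank y' ≤ rank y → FreeAt (κ z y) (site z y'))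
    (hκ1 : ∀ z, ∀ y ∈ A, ∀ η, |κ z y η| ≤ 1) (S : Finset Z)
    (hsep : ∀ z ∈ S, ∀ z' ∈ S, z ≠ z' → ∀ y ∈ A, ∀ y' ∈ A,
      FreeAt (fun η => κ z' y' η * cocc r η (site z' y')) (site z y)) :
    bexp r (fun η => Real.exp (∑ z ∈ S, (4 * s)⁻¹ *
      (∑ y ∈ A, a y * κ z y η * cocc r η (site z y)) ^ 2)) ≤ 2 ^ S.card := by
  induction S using Finset.induction_on with
  | empty => simp [bexp_const]
  | insert z S hz ih =>
    have ih' := ih fun z hz z' hz' => hsep z (Finset.mem_insert_of_mem hz) z'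
      (Finset.mem_insert_of_mem hz')
    have := bexp_exp_sq_mul_le h0 h1 rank (site z) a (κ z)
      (fun η => Real.exp (∑ z ∈ S, (4 * s)⁻¹ *
        (∑ y ∈ A, a y * κ z y η * cocc r η (site z y)) ^ 2)) (fun η => (Real.exp_pos _).le)
      A hs ha (hsite z) (hκ z) (hκ1 z) (fun y hy => by
        refine FreeAt.comp (FreeAt.sum fun z' hz' => ?_) Real.exp
        refine FreeAt.comp (FreeAt.sum fun y' hy' => ?_) fun u => (4 * s)⁻¹ * u ^ 2
        have hne : z ≠ z' := fun h => hz (h ▸ hz')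
        have := hsep z (Finset.mem_insert_self _ _) z' (Finset.mem_insert_of_mem hz') hne
          y hy y' hy'
        exact fun η b => by
          have := this η b
          simp only at this
          simp only [mul_assoc, this])
    rw [Finset.card_insert_of_notMem hz, pow_succ']
    refine le_trans (le_of_eq ?_) (this.trans (by gcongr))
    congr 1; ext η
    rw [Finset.sum_insert hz, Real.exp_add]

/-- The entropy `∫ f log f dν` of a density. -/
def dentropy (r : ℝ) (f : Config V → ℝ) : ℝ := bexp r fun η => f η * Real.log (f η)

theorem dentropy_nonneg {r : ℝ} (h0 : 0 < r) (h1 : r < 1) {f : Config V → ℝ}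
    (hf : ∀ η, 0 < f η) (hf1 : bexp r f = 1) : 0 ≤ dentropy r f := by
  have : bexp r (fun η => f η + (-1)) ≤ dentropy r f := bexp_mono h0 h1 fun η => by
    have := Real.one_sub_inv_le_log_of_pos (hf η)
    have := mul_le_mul_of_nonneg_left this (hf η).le
    have e : f η * (1 - (f η)⁻¹) = f η - 1 := by have := (hf η).ne'; field_simp
    linarith
  rw [bexp_add, hf1, bexp_const] at this
  linarith

/-- The entropy inequality. -/
theorem bexp_mul_le_dentropy_add {r : ℝ} (h0 : 0 < r) (h1 : r < 1) {f : Config V → ℝ}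
    (hf : ∀ η, 0 < f η) (hf1 : bexp r f = 1) (G : Config V → ℝ) {b : ℝ}
    (hG : bexp r (fun η => Real.exp (G η)) ≤ Real.exp b) :
    bexp r (fun η => G η * f η) ≤ dentropy r f + b := by
  have : bexp r (fun η => f η * (G η + -b) + (-1) * (f η * Real.log (f η))) ≤
      bexp r (fun η => Real.exp (-b) * Real.exp (G η) + (-1) * f η) := bexp_mono h0 h1 fun η => by
    -- Pointwise Young inequality f (G − b) − f log f ≤ exp (G − b) − f, from log u ≤ u − 1 at u =
    -- exp (G − b) / f.
    have h := Real.log_le_sub_one_of_pos (x := Real.exp (G η + -b) / f η)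
      (div_pos (Real.exp_pos _) (hf η))
    rw [Real.log_div (Real.exp_pos _).ne' (hf η).ne', Real.log_exp] at h
    have h2 := mul_le_mul_of_nonneg_left h (hf η).le
    have e : f η * (Real.exp (G η + -b) / f η - 1) = Real.exp (G η + -b) - f η := by
      have := (hf η).ne'; field_simp
    rw [e, Real.exp_add] at h2
    linarith
  have e1 : bexp r (fun η => f η * (G η + -b)) = bexp r (fun η => G η * f η) + (-b) := by
    have : (fun η => f η * (G η + -b)) = fun η => G η * f η + (-b) * f η := by ext; ring
    rw [this, bexp_add, bexp_const_mul, hf1, mul_one]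
  rw [bexp_add, bexp_add, bexp_const_mul, bexp_const_mul, bexp_const_mul, hf1, e1] at this
  have h3 : Real.exp (-b) * bexp r (fun η => Real.exp (G η)) ≤ Real.exp (-b) * Real.exp b := by
    gcongr
  rw [← Real.exp_add, neg_add_cancel, Real.exp_zero] at h3
  unfold dentropy
  linarith

end Bernoulli

/-! ### Colouring the torus and entropy bounds for sums of squares -/

/-- A colouring of the cycle by `2 m` colours such that points of the same colour are at distance at
least `m`. -/
theorem exists_coloring_zmod (n m : ℕ) [NeZero n] (hm : 0 < m) :
    ∃ col : ZMod n → ℕ, (∀ a, col a < 2 * m) ∧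
      ∀ a b, a ≠ b → col a = col b → ∀ p q : ℕ, p < m → q < m → a + p ≠ b + q := by
  -- Complete blocks of length `m` are coloured by the residue mod `m`. The incomplete last block
  -- gets `m` colours of its own, so that wrapping around the cycle creates no conflict.
  refine ⟨fun a => if a.val < m * (n / m) then a.val % m else m + a.val % m, fun a => ?_, ?_⟩
  · have := Nat.mod_lt a.val hm
    dsimp only; split_ifs <;> omega
  have main : ∀ a b : ZMod n, a.val < b.val →
      (if a.val < m * (n / m) then a.val % m else m + a.val % m) =
        (if b.val < m * (n / m) then b.val % m else m + b.val % m) →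
      ∀ p q : ℕ, p < m → q < m → a + p ≠ b + q := by
    intro a b hab hcol p q hp hq h
    have ha := Nat.mod_lt a.val hm
    have hb := Nat.mod_lt b.val hm
    have hbn := ZMod.val_lt b
    have ea := Nat.div_add_mod a.val m
    have eb := Nat.div_add_mod b.val m
    have en := Nat.div_add_mod n m
    have enm := Nat.mod_lt n hm
    have hmod : a.val % m = b.val % m := by
      split_ifs at hcol <;> omega
    have hdiv : a.val / m < b.val / m := by
      by_contra hlt
      have := Nat.mul_le_mul_left m (not_lt.1 hlt)
      omega
    have h1 : m * (a.val / m) + m ≤ m * (b.val / m) := by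
      have := Nat.mul_le_mul_left m (Nat.succ_le_of_lt hdiv)
      rwa [Nat.mul_succ] at this
    have h2 : b.val < m * (n / m) := by
      by_contra hge
      have hba : b.val / m ≤ n / m := Nat.div_le_div_right hbn.le
      have h3 := Nat.mul_le_mul_left m hba
      split_ifs at hcol <;> omega
    have hbq : b.val / m < n / m := by
      by_contra hlt
      have := Nat.mul_le_mul_left m (not_lt.1 hlt)
      omega
    have h3 : m * (b.val / m) + m ≤ m * (n / m) := by
      have := Nat.mul_le_mul_left m (Nat.succ_le_of_lt hbq)
      rwa [Nat.mul_succ] at this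
    have h4 : ((a.val + p : ℕ) : ZMod n) = ((b.val + q : ℕ) : ZMod n) := by
      push_cast; rw [ZMod.natCast_zmod_val, ZMod.natCast_zmod_val, h]
    rw [ZMod.natCast_eq_natCast_iff] at h4
    have h5 := (Nat.modEq_iff_dvd' (by omega)).1 h4
    have := Nat.le_of_dvd (by omega) h5
    omega
  intro a b hab hcol p q hp hq
  rcases lt_trichotomy a.val b.val with h | h | h
  · exact main a b h hcol p q hp hq
  · exact absurd (ZMod.val_injective n h) hab
  · exact fun h' => main b a h hcol.symm q p hq hp h'.symm

/-- The point `s y` of the torus. -/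
def scaled {d n : ℕ} (s : ZMod n) (y : Fin d →₀ ℕ) : Torus d n := fun i => s * (y i : ZMod n)

theorem scaled_add {d n : ℕ} (s : ZMod n) (y y' : Fin d →₀ ℕ) :
    scaled s (y + y') = scaled s y + scaled s y' := by
  ext i; simp [scaled, mul_add]

theorem scaled_single {d n : ℕ} (s : ZMod n) (j : Fin d) :
    scaled s (Finsupp.single j 1) = s • unitVec j := by
  ext i
  by_cases h : i = j
  · subst h; simp [scaled, unitVec]
  · simp [scaled, unitVec, h]

/-- The local function `η̄_u` (for `o = none`) or `η̄_u η̄_{u + s e_j}` (for `o = some j`). -/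
def pattern {d n : ℕ} (r : ℝ) (s : ZMod n) (o : Option (Fin d)) (η : Config (Torus d n))
    (u : Torus d n) : ℝ :=
  (o.elim 1 fun j => cocc r η (u + s • unitVec j)) * cocc r η u

theorem natCast_zmod_inj {n a b : ℕ} (ha : a < n) (hb : b < n)
    (h : (a : ZMod n) = (b : ZMod n)) : a = b := by
  rw [ZMod.natCast_eq_natCast_iff] at h
  exact Nat.ModEq.eq_of_lt_of_lt h ha hb

theorem mul_left_cancel_sign {n : ℕ} {s a b : ZMod n} (hs : s = 1 ∨ s = -1) (h : s * a = s * b) :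
    a = b := by
  rcases hs with rfl | rfl
  · simpa using h
  · simpa using h

theorem freeAt_pattern {d n : ℕ} [NeZero n] (r : ℝ) (s : ZMod n) (o : Option (Fin d))
    {u v : Torus d n} (h1 : u ≠ v) (h2 : ∀ j ∈ o, u + s • unitVec j ≠ v) :
    FreeAt (fun η => pattern r s o η u) v := by
  refine FreeAt.mul ?_ (freeAt_cocc r h1)
  cases o with
  | none => exact freeAt_const 1 v
  | some j => exact freeAt_cocc r (h2 j rfl)

theorem abs_tail_le {d n : ℕ} [NeZero n] {r : ℝ} (h0 : 0 < r) (h1 : r < 1) (s : ZMod n)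
    (o : Option (Fin d)) (u : Torus d n) (η : Config (Torus d n)) :
    |o.elim 1 fun j => cocc r η (u + s • unitVec j)| ≤ 1 := by
  cases o with
  | none => simp
  | some j => exact abs_cocc_le h0 h1 _ _

/-- Entropy bound for the sum over the torus of the squares of weighted sums of local functions. -/
theorem sum_bexp_sq_pattern_le {d n : ℕ} [NeZero n] {r : ℝ} (h0 : 0 < r) (h1 : r < 1)
    {s : ZMod n} (hs : s = 1 ∨ s = -1) (o : Option (Fin d)) (A : Finset (Fin d →₀ ℕ))
    (a : (Fin d →₀ ℕ) → ℝ) {L : ℕ} (hL : L < n) (hA : ∀ y ∈ A, ∀ k, y k < L)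
    {σ : ℝ} (hσ : 0 < σ) (ha : ∑ y ∈ A, a y ^ 2 ≤ σ) {f : Config (Torus d n) → ℝ}
    (hf : ∀ η, 0 < f η) (hf1 : bexp r f = 1) :
    ∑ z : Torus d n, bexp r (fun η =>
        (∑ y ∈ A, a y * pattern r s o η (z + scaled s y)) ^ 2 * f η) ≤
      4 * σ * ((2 * (L + 1)) ^ d * dentropy r f + n ^ d) := by
  classical
  -- Offsets are below `L`, but the second site of a pattern lies one step further, hence blocks of
  -- side `L + 1`.
  obtain ⟨col, hcol, hsep⟩ := exists_coloring_zmod n (L + 1) (Nat.succ_pos L)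
  let colour : Torus d n → Fin d → ℕ := fun z i => col (z i)
  let T : Finset (Fin d → ℕ) := Fintype.piFinset fun _ => Finset.range (2 * (L + 1))
  have hT : ∀ z ∈ (Finset.univ : Finset (Torus d n)), colour z ∈ T := fun z _ => by
    simp only [T, Fintype.mem_piFinset, Finset.mem_range]; exact fun i => hcol _
  have hsep' : ∀ z z', z ≠ z' → colour z = colour z' → ∀ y y' : Fin d →₀ ℕ,
      (∀ k, y k < L + 1) → (∀ k, y' k < L + 1) → z + scaled s y ≠ z' + scaled s y' := by
    intro z z' hne hc y y' hy hy' he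
    obtain ⟨i, hi⟩ := Function.ne_iff.1 hne
    have e := congrFun he i
    have hci := congrFun hc i
    simp only [Pi.add_apply, scaled] at e
    rcases hs with rfl | rfl
    · rw [one_mul, one_mul] at e
      exact hsep _ _ hi hci _ _ (hy i) (hy' i) e
    · refine hsep _ _ hi hci _ _ (hy' i) (hy i) ?_
      linear_combination e
  let h : Torus d n → Config (Torus d n) → ℝ := fun z η =>
    ∑ y ∈ A, a y * pattern r s o η (z + scaled s y)
  have hclass : ∀ c : Fin d → ℕ,
      ∑ z with colour z = c, bexp r (fun η => (4 * σ)⁻¹ * (h z η ^ 2 * f η)) ≤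
        dentropy r f + (Finset.univ.filter fun z => colour z = c).card := by
    intro c
    set S : Finset (Torus d n) := Finset.univ.filter fun z => colour z = c with hS
    have hmem : ∀ z ∈ S, colour z = c := fun z hz => (Finset.mem_filter.1 hz).2
    -- Offsets are ranked by their j-th coordinate. The second site of the pattern at y has rank y_j
    -- + 1, so it differs from every base site of rank at most y_j, as the sequential integration
    -- requires.
    have key := bexp_exp_sum_sq_le h0 h1 (fun y : Fin d →₀ ℕ => o.elim 0 fun j => y j)
      (fun z y => z + scaled s y) a
      (fun (z : Torus d n) y η => o.elim 1 fun j => cocc r η (z + scaled s y + s • unitVec j))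
      A hσ ha
      (fun z y hy y' hy' he => by
        ext i
        have e := mul_left_cancel_sign hs (congrFun (add_left_cancel he) i)
        exact natCast_zmod_inj ((hA y hy i).trans hL) ((hA y' hy' i).trans hL) e)
      (fun z y hy y' hy' hle => by
        cases o with
        | none => exact freeAt_const 1 _
        | some j =>
          refine freeAt_cocc r fun he => ?_
          rw [← scaled_single, add_assoc, ← scaled_add] at he
          have e := mul_left_cancel_sign hs (congrFun (add_left_cancel he) j)
          have hyj := hA y hy j
          have hyj' := hA y' hy' j
          have := natCast_zmod_inj (by simp; omega) (by omega) e
          simp at this hle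
          omega)
      (fun z y hy η => abs_tail_le h0 h1 s o _ η) S
      (fun z hz z' hz' hne y hy y' hy' => by
        have hc : colour z' = colour z := by rw [hmem z hz, hmem z' hz']
        refine freeAt_pattern r s o (hsep' z' z hne.symm hc y' y
          (fun k => (hA y' hy' k).trans (Nat.lt_succ_self L))
          (fun k => (hA y hy k).trans (Nat.lt_succ_self L))) fun j _ => ?_
        rw [← scaled_single, add_assoc, ← scaled_add]
        refine hsep' z' z hne.symm hc _ y (fun k => ?_)
          (fun k => (hA y hy k).trans (Nat.lt_succ_self L))
        have := hA y' hy' k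
        have h2 : (Finsupp.single j 1 : Fin d →₀ ℕ) k ≤ 1 := by
          rw [Finsupp.single_apply]; split_ifs <;> simp
        rw [Finsupp.add_apply]; omega)
    have hexp : (2 : ℝ) ^ S.card ≤ Real.exp S.card := by
      rw [← Real.exp_one_pow]
      have := Real.add_one_le_exp (1 : ℝ)
      gcongr
      linarith
    have := bexp_mul_le_dentropy_add h0 h1 hf hf1 _ (key.trans hexp)
    rw [← bexp_sum]
    refine le_trans (le_of_eq ?_) this
    congr 1; ext η
    rw [Finset.sum_mul]
    refine Finset.sum_congr rfl fun z _ => ?_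
    rw [← mul_assoc]
    congr 3
    exact Finset.sum_congr rfl fun y _ => by simp only [pattern, mul_assoc]
  have hsum : ∑ z : Torus d n, bexp r (fun η => (4 * σ)⁻¹ * (h z η ^ 2 * f η)) ≤
      (2 * (L + 1)) ^ d * dentropy r f + n ^ d := by
    -- The entropy is paid once per colour class, while the cardinalities of the classes add up to
    -- n^d.
    rw [← Finset.sum_fiberwise_of_maps_to hT]
    refine (Finset.sum_le_sum fun c _ => hclass c).trans (le_of_eq ?_)
    rw [Finset.sum_add_distrib, Finset.sum_const, nsmul_eq_mul]
    congr 1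
    · simp [T]
    · rw [← Nat.cast_sum, ← Finset.card_eq_sum_card_fiberwise hT]
      simp [ZMod.card]
  simp only [bexp_const_mul, ← Finset.mul_sum] at hsum
  rw [inv_mul_le_iff₀ (by positivity)] at hsum
  exact hsum

/-! ### Flows on the lattice, encoded by generating polynomials -/

section Flow

open MvPolynomial

variable {d : ℕ}

/-- All coefficients are nonnegative. -/
def NonnegCoeff (P : MvPolynomial (Fin d) ℝ) : Prop := ∀ y, 0 ≤ P.coeff y

/-- The sum of the coefficients. -/
def mass (P : MvPolynomial (Fin d) ℝ) : ℝ := eval (fun _ => 1) P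

theorem NonnegCoeff.add {P Q : MvPolynomial (Fin d) ℝ} (hP : NonnegCoeff P) (hQ : NonnegCoeff Q) :
    NonnegCoeff (P + Q) := fun y => by rw [coeff_add]; exact add_nonneg (hP y) (hQ y)

theorem NonnegCoeff.mul {P Q : MvPolynomial (Fin d) ℝ} (hP : NonnegCoeff P) (hQ : NonnegCoeff Q) :
    NonnegCoeff (P * Q) := fun y => by
  rw [coeff_mul]; exact Finset.sum_nonneg fun _ _ => mul_nonneg (hP _) (hQ _)

theorem nonnegCoeff_C {c : ℝ} (hc : 0 ≤ c) : NonnegCoeff (C c : MvPolynomial (Fin d) ℝ) :=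
  fun y => by rw [coeff_C]; split_ifs <;> simp [hc]

theorem nonnegCoeff_one : NonnegCoeff (1 : MvPolynomial (Fin d) ℝ) := by
  rw [← C_1]; exact nonnegCoeff_C zero_le_one

theorem nonnegCoeff_X_pow (i : Fin d) (t : ℕ) : NonnegCoeff (X i ^ t : MvPolynomial (Fin d) ℝ) :=
  fun y => by rw [coeff_X_pow]; split_ifs <;> simp

theorem NonnegCoeff.sum {ι : Type*} {s : Finset ι} {P : ι → MvPolynomial (Fin d) ℝ}
    (hP : ∀ i ∈ s, NonnegCoeff (P i)) : NonnegCoeff (∑ i ∈ s, P i) := fun y => by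
  rw [coeff_sum]; exact Finset.sum_nonneg fun i hi => hP i hi y

theorem NonnegCoeff.prod {ι : Type*} {s : Finset ι} {P : ι → MvPolynomial (Fin d) ℝ}
    (hP : ∀ i ∈ s, NonnegCoeff (P i)) : NonnegCoeff (∏ i ∈ s, P i) :=
  Finset.prod_induction P NonnegCoeff (fun _ _ => NonnegCoeff.mul) nonnegCoeff_one hP

theorem mass_eq (P : MvPolynomial (Fin d) ℝ) : mass P = ∑ y ∈ P.support, P.coeff y := by
  simp [mass, eval_eq]

theorem sum_coeff_le_mass {P : MvPolynomial (Fin d) ℝ} (hP : NonnegCoeff P)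
    (A : Finset (Fin d →₀ ℕ)) : ∑ y ∈ A, P.coeff y ≤ mass P := by
  classical
  rw [mass_eq]
  calc _ ≤ ∑ y ∈ A ∪ P.support, P.coeff y :=
        Finset.sum_le_sum_of_subset_of_nonneg Finset.subset_union_left fun y _ _ => hP y
    _ = _ := by
        refine (Finset.sum_subset Finset.subset_union_right fun y _ hy => ?_).symm
        exact notMem_support_iff.1 hy

/-- Young's inequality for convolution: ℓ¹ ∗ ℓ^∞ ⊆ ℓ^∞. -/
theorem coeff_mul_le_mass_mul {P Q : MvPolynomial (Fin d) ℝ} {K : ℝ} (hP : NonnegCoeff P)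
    (hK : 0 ≤ K) (hQK : ∀ y, Q.coeff y ≤ K) (y : Fin d →₀ ℕ) :
    (P * Q).coeff y ≤ mass P * K := by
  classical
  rw [coeff_mul]
  calc _ ≤ ∑ x ∈ Finset.HasAntidiagonal.antidiagonal y, P.coeff x.1 * K :=
        Finset.sum_le_sum fun x _ => mul_le_mul_of_nonneg_left (hQK _) (hP _)
    _ = (∑ x ∈ (Finset.HasAntidiagonal.antidiagonal y).image Prod.fst, P.coeff x) * K := by
        rw [Finset.sum_image, Finset.sum_mul]
        intro a ha b hb hab
        simp only [Finset.mem_coe, Finset.HasAntidiagonal.mem_antidiagonal] at ha hb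
        have hab' : a.1 = b.1 := hab
        refine Prod.ext hab' ?_
        rw [← hb, hab'] at ha
        exact add_left_cancel ha
    _ ≤ _ := mul_le_mul_of_nonneg_right (sum_coeff_le_mass hP _) hK

/-- Energy cost of adding an increment: (p + q)² = p² + q (2p + q), with q bounded in sup norm and
2p + q in ℓ¹. No orthogonality between scales is needed. -/
theorem sum_coeff_add_sq_le {P Q : MvPolynomial (Fin d) ℝ} {K s : ℝ} (hP : NonnegCoeff P)
    (hQ : NonnegCoeff Q) (hK : 0 ≤ K) (hQK : ∀ y, Q.coeff y ≤ K) {A : Finset (Fin d →₀ ℕ)}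
    (hs : ∑ y ∈ A, P.coeff y ^ 2 ≤ s) :
    ∑ y ∈ A, (P + Q).coeff y ^ 2 ≤ s + K * (2 * mass P + mass Q) := by
  calc _ ≤ ∑ y ∈ A, (P.coeff y ^ 2 + K * (2 * P.coeff y + Q.coeff y)) := by
        refine Finset.sum_le_sum fun y _ => ?_
        have : Q.coeff y * (2 * P.coeff y + Q.coeff y) ≤ K * (2 * P.coeff y + Q.coeff y) :=
          mul_le_mul_of_nonneg_right (hQK y) (by linarith [hP y, hQ y])
        rw [coeff_add]
        linarith
    _ = ∑ y ∈ A, P.coeff y ^ 2 + K * (2 * ∑ y ∈ A, P.coeff y + ∑ y ∈ A, Q.coeff y) := by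
        rw [Finset.sum_add_distrib, ← Finset.mul_sum, Finset.sum_add_distrib, ← Finset.mul_sum]
    _ ≤ _ := by
        have := sum_coeff_le_mass hP A
        have := sum_coeff_le_mass hQ A
        gcongr

/-- The generating polynomial of the uniform measure on the box of side `2 ^ k`. -/
def avgPoly (d k : ℕ) : MvPolynomial (Fin d) ℝ :=
  ∏ i, (C ((2 : ℝ) ^ k)⁻¹ * ∑ t ∈ Finset.range (2 ^ k), X i ^ t)

theorem avgPoly_nonneg (d k : ℕ) : NonnegCoeff (avgPoly d k) :=
  NonnegCoeff.prod fun i _ => (nonnegCoeff_C (by positivity)).mul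
    (NonnegCoeff.sum fun t _ => nonnegCoeff_X_pow i t)

theorem mass_avgPoly (d k : ℕ) : mass (avgPoly d k) = 1 := by
  simp [mass, avgPoly]

theorem degreeOf_geom_sum_le (k i : Fin d) (N : ℕ) :
    degreeOf k (∑ t ∈ Finset.range N, X i ^ t : MvPolynomial (Fin d) ℝ) ≤
      if k = i then N - 1 else 0 := by
  refine (degreeOf_sum_le k _ _).trans (Finset.sup_le fun t ht => ?_)
  have := Finset.mem_range.1 ht
  split_ifs with h
  · subst h; rw [degreeOf_X_self_pow]; omega
  · rw [degreeOf_X_pow_of_ne _ h]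

theorem degreeOf_avgPoly_le (k : Fin d) (m : ℕ) : degreeOf k (avgPoly d m) ≤ 2 ^ m - 1 := by
  refine (degreeOf_prod_le k _ _).trans ?_
  calc _ ≤ ∑ i : Fin d, if k = i then 2 ^ m - 1 else 0 :=
        Finset.sum_le_sum fun i _ => (degreeOf_C_mul_le _ _ _).trans (degreeOf_geom_sum_le k i _)
    _ = _ := by simp

/-- Each point of the box occurs exactly once when the product is expanded. -/
theorem coeff_avgPoly_le (d k : ℕ) (y : Fin d →₀ ℕ) :
    (avgPoly d k).coeff y ≤ ((2 : ℝ) ^ k)⁻¹ ^ d := by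
  classical
  have e : avgPoly d k = C (((2 : ℝ) ^ k)⁻¹ ^ d) *
      ∑ x ∈ Fintype.piFinset fun _ : Fin d => Finset.range (2 ^ k),
        monomial (Finsupp.equivFunOnFinite.symm x) 1 := by
    unfold avgPoly
    rw [Finset.prod_mul_distrib, Finset.prod_univ_sum]
    congr 1
    · rw [Finset.prod_const, Finset.card_univ, Fintype.card_fin, ← C_pow]
    · refine Finset.sum_congr rfl fun x _ => ?_
      rw [monomial_eq, C_1, one_mul, Finsupp.prod_fintype _ _ (by simp)]
      simp
  rw [e, coeff_C_mul, coeff_sum]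
  refine mul_le_of_le_one_right (by positivity) ?_
  simp only [coeff_monomial]
  have : ∀ x : Fin d → ℕ, (if Finsupp.equivFunOnFinite.symm x = y then (1 : ℝ) else 0) =
      if x = Finsupp.equivFunOnFinite y then 1 else 0 := fun x => by
    simp only [Equiv.symm_apply_eq]
  simp only [this, Finset.sum_ite_eq']
  split_ifs <;> simp

/-- The generating polynomial of the uniform measure on `{0, N e_i}`. -/
def halfStep (N : ℕ) (i : Fin d) : MvPolynomial (Fin d) ℝ := C (1 / 2) * (1 + X i ^ N)

/-- Doubling the side of a box is convolution with the uniform measure on the corners {0, 2^k}^d,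
which makes the flow telescope over dyadic scales. -/
theorem avgPoly_succ (d k : ℕ) : avgPoly d (k + 1) = avgPoly d k * ∏ i, halfStep (2 ^ k) i := by
  unfold avgPoly halfStep
  rw [← Finset.prod_mul_distrib]
  refine Finset.prod_congr rfl fun i _ => ?_
  have h : ∑ t ∈ Finset.range (2 ^ (k + 1)), (X i ^ t : MvPolynomial (Fin d) ℝ) =
      (∑ t ∈ Finset.range (2 ^ k), X i ^ t) * (1 + X i ^ 2 ^ k) := by
    rw [pow_succ, mul_two, Finset.sum_range_add, mul_add, mul_one, Finset.sum_mul]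
    congr 1
    exact Finset.sum_congr rfl fun t _ => by rw [pow_add, mul_comm]
  have hc : (C ((2 : ℝ) ^ (k + 1))⁻¹ : MvPolynomial (Fin d) ℝ) = C ((2 : ℝ) ^ k)⁻¹ * C (1 / 2) := by
    rw [← C_mul]; congr 1; rw [pow_succ, mul_inv]; norm_num
  rw [h, hc]; ring

theorem halfStep_nonneg (N : ℕ) (i : Fin d) : NonnegCoeff (halfStep N i) :=
  (nonnegCoeff_C (by norm_num)).mul (nonnegCoeff_one.add (nonnegCoeff_X_pow i N))

theorem mass_halfStep (N : ℕ) (i : Fin d) : mass (halfStep N i) = 1 := by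
  simp [mass, halfStep]; norm_num

theorem degreeOf_halfStep_le (N : ℕ) (k i : Fin d) :
    degreeOf k (halfStep N i) ≤ if k = i then N else 0 := by
  refine (degreeOf_C_mul_le _ _ _).trans ((degreeOf_add_le _ _ _).trans ?_)
  split_ifs with h
  · subst h; simp
  · simp [degreeOf_X_pow_of_ne _ h]

/-- The flow in direction `i` that transports `1` to the square of the product of the half steps. -/
def stepFlow (N : ℕ) (i : Fin d) : MvPolynomial (Fin d) ℝ :=
  C (1 / 2) * (1 + halfStep N i) * (∑ t ∈ Finset.range N, X i ^ t) *
    ∏ j with j < i, halfStep N j ^ 2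

/-- Telescoping over coordinates, 1 − ∏ h_i² = ∑ (1 − h_i²) ∏_{j<i} h_j². Here 1 − h² = (1 + h)(1 −
h), and 1 − h = (1 − X^N) / 2 is a geometric sum times 1 − X. -/
theorem stepFlow_spec (N : ℕ) :
    1 - (∏ i : Fin d, halfStep N i) ^ 2 = ∑ i, stepFlow N i * (1 - X i) := by
  have h := Finset.prod_one_sub_ordered (Finset.univ : Finset (Fin d))
    (fun i => 1 - halfStep N i ^ 2)
  simp only [sub_sub_cancel] at h
  rw [← Finset.prod_pow, h, sub_sub_cancel]
  refine Finset.sum_congr rfl fun i _ => ?_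
  have hg := geom_sum_mul_neg (X i : MvPolynomial (Fin d) ℝ) N
  have h2 : (C (1 / 2) : MvPolynomial (Fin d) ℝ) * 2 = 1 := by
    rw [show (2 : MvPolynomial (Fin d) ℝ) = C 2 from (map_ofNat C 2).symm, ← C_mul, ← C_1]
    congr 1; norm_num
  unfold stepFlow
  have h3 : 1 - halfStep N i = C (1 / 2) * (1 - X i ^ N) := by
    unfold halfStep
    linear_combination -h2
  rw [show C (1 / 2) * (1 + halfStep N i) * (∑ t ∈ Finset.range N, X i ^ t) *
    (∏ j with j < i, halfStep N j ^ 2) * (1 - X i) = (C (1 / 2) * ((∑ t ∈ Finset.range N, X i ^ t) *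
      (1 - X i))) * (1 + halfStep N i) * ∏ j with j < i, halfStep N j ^ 2 by ring, hg, ← h3]
  ring

theorem stepFlow_nonneg (N : ℕ) (i : Fin d) : NonnegCoeff (stepFlow N i) := by
  refine ((NonnegCoeff.mul (nonnegCoeff_C (by norm_num)) (nonnegCoeff_one.add
    (halfStep_nonneg N i))).mul (NonnegCoeff.sum fun t _ => nonnegCoeff_X_pow i t)).mul
    (NonnegCoeff.prod fun j _ => ?_)
  rw [sq]; exact (halfStep_nonneg N j).mul (halfStep_nonneg N j)

theorem mass_stepFlow (N : ℕ) (i : Fin d) : mass (stepFlow N i) = N := by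
  have h : ∀ j : Fin d, eval (fun _ => (1 : ℝ)) (halfStep N j) = 1 := mass_halfStep N
  simp [mass, stepFlow, h]
  norm_num

theorem degreeOf_stepFlow_le (N : ℕ) (k i : Fin d) : degreeOf k (stepFlow N i) ≤ 2 * N := by
  unfold stepFlow
  refine (degreeOf_mul_le _ _ _).trans ?_
  have h1 : degreeOf k (C (1 / 2) * (1 + halfStep N i) *
      (∑ t ∈ Finset.range N, X i ^ t) : MvPolynomial (Fin d) ℝ) ≤ if k = i then 2 * N else 0 := by
    refine (degreeOf_mul_le _ _ _).trans ?_
    have a := (degreeOf_C_mul_le (1 + halfStep N i) k (1 / 2 : ℝ)).trans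
      (degreeOf_add_le k 1 (halfStep N i))
    have b := degreeOf_halfStep_le N k i
    have c := degreeOf_geom_sum_le k i N
    rw [degreeOf_one] at a
    split_ifs at b c ⊢ <;> omega
  have h2 : degreeOf k (∏ j with j < i, halfStep N j ^ 2 : MvPolynomial (Fin d) ℝ) ≤
      if k < i then 2 * N else 0 := by
    refine (degreeOf_prod_le _ _ _).trans ?_
    calc _ ≤ ∑ j with j < i, (if k = j then 2 * N else 0) := by
          refine Finset.sum_le_sum fun j _ => (degreeOf_pow_le _ _ _).trans ?_
          have b := degreeOf_halfStep_le N k j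
          split_ifs at b ⊢ <;> omega
      _ = _ := by
          rw [Finset.sum_ite_eq]; simp
  split_ifs at h1 h2 <;> omega

/-- A flow from the origin to the two-fold convolution of the uniform measure on a dyadic box,
with an optimal bound on its energy. -/
theorem exists_flow (d M : ℕ) : ∃ Φ : Fin d → MvPolynomial (Fin d) ℝ,
    (∀ i, NonnegCoeff (Φ i)) ∧ (∀ i, mass (Φ i) ≤ 2 ^ M) ∧
    (∀ i (A : Finset (Fin d →₀ ℕ)), ∑ y ∈ A, (Φ i).coeff y ^ 2 ≤
      3 * ∑ m ∈ Finset.range M, ((2 : ℝ) ^ m) ^ 2 * ((2 : ℝ) ^ m)⁻¹ ^ d) ∧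
    (∀ i k, degreeOf k (Φ i) < 2 * 2 ^ M) ∧
    1 - avgPoly d M ^ 2 = ∑ i, Φ i * (1 - X i) := by
  induction M with
  | zero =>
    refine ⟨fun _ => 0, fun i y => by simp, fun i => by simp [mass], fun i A => by simp,
      fun i k => by simp, by simp [avgPoly]⟩
  | succ M ih =>
    obtain ⟨Φ, h1, h2, h3, h4, h5⟩ := ih
    have hn : ∀ i, NonnegCoeff (avgPoly d M ^ 2 * stepFlow (2 ^ M) i) := fun i => by
      rw [sq]
      exact ((avgPoly_nonneg d M).mul (avgPoly_nonneg d M)).mul (stepFlow_nonneg _ i)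
    have hm : ∀ i : Fin d, mass (avgPoly d M ^ 2 * stepFlow (2 ^ M) i) = 2 ^ M := fun i => by
      have a := mass_avgPoly d M
      have b := mass_stepFlow (2 ^ M) i
      unfold mass at *
      rw [map_mul, map_pow, a, b]; simp
    -- One more scale: with p_{M+1} = p_M ∏ h_i, 1 − p_{M+1}² = (1 − p_M²) + p_M² (1 − ∏ h_i²).
    refine ⟨fun i => Φ i + avgPoly d M ^ 2 * stepFlow (2 ^ M) i, fun i => (h1 i).add (hn i),
      fun i => ?_, fun i A => ?_, fun i k => ?_, ?_⟩
    · have := h2 i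
      have e : mass (Φ i + avgPoly d M ^ 2 * stepFlow (2 ^ M) i) =
        mass (Φ i) + mass (avgPoly d M ^ 2 * stepFlow (2 ^ M) i) := map_add _ _ _
      rw [e, hm, pow_succ]; linarith
    -- The increment has mass 2^M and, one factor p_M being kept for its sup norm, coefficients at
    -- most 2^M · 2^{−Md}. The earlier flow has mass at most 2^M, so the added energy is at most 2^M
    -- · 2^{−Md} · (2 · 2^M + 2^M); hence the constant 3.
    · have hK : ∀ y, (avgPoly d M ^ 2 * stepFlow (2 ^ M) i).coeff y ≤
          2 ^ M * ((2 : ℝ) ^ M)⁻¹ ^ d := fun y => by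
        have := coeff_mul_le_mass_mul ((avgPoly_nonneg d M).mul (stepFlow_nonneg (2 ^ M) i))
          (by positivity) (coeff_avgPoly_le d M) y
        have a := mass_avgPoly d M
        have b := mass_stepFlow (2 ^ M) i
        have e : mass (avgPoly d M * stepFlow (2 ^ M) i) = 2 ^ M := by
          unfold mass at *
          rw [map_mul, a, b]; simp
        rw [e] at this
        rw [show avgPoly d M ^ 2 * stepFlow (2 ^ M) i =
          avgPoly d M * stepFlow (2 ^ M) i * avgPoly d M by ring]
        exact this
      refine (sum_coeff_add_sq_le (h1 i) (hn i) (by positivity) hK (h3 i A)).trans ?_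
      rw [hm, Finset.sum_range_succ, mul_add]
      have : (2 : ℝ) ^ M * ((2 : ℝ) ^ M)⁻¹ ^ d * (2 * mass (Φ i) + 2 ^ M) ≤
          (2 : ℝ) ^ M * ((2 : ℝ) ^ M)⁻¹ ^ d * (2 * 2 ^ M + 2 ^ M) := by
        have := h2 i
        gcongr
      linarith
    · refine (degreeOf_add_le _ _ _).trans_lt (max_lt ?_ ?_)
      · have := h4 i k
        rw [pow_succ]; omega
      · have a := degreeOf_mul_le k (avgPoly d M ^ 2) (stepFlow (2 ^ M) i)
        have b := degreeOf_pow_le k (avgPoly d M) 2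
        have c := degreeOf_avgPoly_le k M (d := d)
        have e := degreeOf_stepFlow_le (2 ^ M) k i
        have f : 0 < 2 ^ M := by positivity
        rw [pow_succ 2 M]; omega
    · rw [avgPoly_succ, mul_pow]
      have := stepFlow_spec (d := d) (2 ^ M)
      simp only [add_mul, Finset.sum_add_distrib, ← h5, mul_assoc, ← Finset.mul_sum, ← this]
      ring

end Flow

/-! ### Polynomials acting by translations, and summation by parts -/

section Action

open MvPolynomial

variable {d n : ℕ}

/-- The action of a polynomial on functions on the torus, the variable `X i` acting as the
translation by `s e_i`. -/
def polyAct (s : ZMod n) (P : MvPolynomial (Fin d) ℝ) (g : Torus d n → ℝ) (x : Torus d n) : ℝ :=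
  ∑ y ∈ P.support, P.coeff y * g (x + scaled s y)

theorem polyAct_of_subset (s : ZMod n) {P : MvPolynomial (Fin d) ℝ} {A : Finset (Fin d →₀ ℕ)}
    (hA : P.support ⊆ A) (g : Torus d n → ℝ) (x : Torus d n) :
    polyAct s P g x = ∑ y ∈ A, P.coeff y * g (x + scaled s y) :=
  Finset.sum_subset hA fun y _ hy => by rw [notMem_support_iff.1 hy, zero_mul]

theorem polyAct_add (s : ZMod n) (P Q : MvPolynomial (Fin d) ℝ) (g : Torus d n → ℝ)
    (x : Torus d n) : polyAct s (P + Q) g x = polyAct s P g x + polyAct s Q g x := by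
  classical
  rw [polyAct_of_subset s (support_add (p := P) (q := Q)),
    polyAct_of_subset s (Finset.subset_union_left (s₁ := P.support) (s₂ := Q.support)),
    polyAct_of_subset s (Finset.subset_union_right (s₁ := P.support) (s₂ := Q.support)),
    ← Finset.sum_add_distrib]
  exact Finset.sum_congr rfl fun y _ => by rw [coeff_add, add_mul]

theorem polyAct_zero (s : ZMod n) (g : Torus d n → ℝ) (x : Torus d n) :
    polyAct s 0 g x = 0 := by simp [polyAct]

theorem polyAct_sum {ι : Type*} (s : ZMod n) (A : Finset ι) (P : ι → MvPolynomial (Fin d) ℝ)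
    (g : Torus d n → ℝ) (x : Torus d n) :
    polyAct s (∑ i ∈ A, P i) g x = ∑ i ∈ A, polyAct s (P i) g x := by
  classical
  induction A using Finset.induction_on with
  | empty => simp [polyAct_zero]
  | insert a A ha ih => rw [Finset.sum_insert ha, Finset.sum_insert ha, polyAct_add, ih]

theorem polyAct_monomial (s : ZMod n) (y : Fin d →₀ ℕ) (c : ℝ) (g : Torus d n → ℝ)
    (x : Torus d n) : polyAct s (monomial y c) g x = c * g (x + scaled s y) := by
  classical
  rw [polyAct_of_subset s support_monomial_subset]
  simp

theorem polyAct_mul (s : ZMod n) (P Q : MvPolynomial (Fin d) ℝ) (g : Torus d n → ℝ)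
    (x : Torus d n) : polyAct s (P * Q) g x = polyAct s P (polyAct s Q g) x := by
  induction P using MvPolynomial.induction_on' with
  | add P P' h h' => rw [add_mul, polyAct_add, polyAct_add, h, h']
  | monomial y c =>
    induction Q using MvPolynomial.induction_on' with
    | add Q Q' h h' =>
      rw [mul_add, polyAct_add, h, h', polyAct_monomial, polyAct_monomial, polyAct_monomial,
        polyAct_add, mul_add]
    | monomial y' c' =>
      rw [monomial_mul, polyAct_monomial, polyAct_monomial, polyAct_monomial, scaled_add,
        ← add_assoc, mul_assoc]

theorem scaled_zero (s : ZMod n) : scaled s (0 : Fin d →₀ ℕ) = 0 := by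
  ext i; simp [scaled]

theorem polyAct_one_sub_X (i : Fin d) (g : Torus d n → ℝ) (x : Torus d n) :
    polyAct 1 (1 - X i) g x = g x - g (x + unitVec i) := by
  have e : (1 - X i : MvPolynomial (Fin d) ℝ) = monomial 0 1 + monomial (Finsupp.single i 1) (-1) := by
    rw [map_neg, sub_eq_add_neg]; rfl
  rw [e, polyAct_add, polyAct_monomial, polyAct_monomial, scaled_zero, scaled_single]
  simp; ring

theorem polyAct_one (g : Torus d n → ℝ) (x : Torus d n) : polyAct 1 1 g x = g x := by
  rw [show (1 : MvPolynomial (Fin d) ℝ) = monomial 0 1 from rfl, polyAct_monomial, scaled_zero]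
  simp

/-- Translations are invertible on the torus, so the adjoint of a polynomial in them uses the
opposite translations: the weights are then read behind z. -/
theorem sum_mul_polyAct [NeZero n] (P : MvPolynomial (Fin d) ℝ) (ω g : Torus d n → ℝ) :
    ∑ x, ω x * polyAct 1 P g x = ∑ z, polyAct (-1) P ω z * g z := by
  simp only [polyAct, Finset.mul_sum, Finset.sum_mul]
  rw [Finset.sum_comm]
  conv_rhs => rw [Finset.sum_comm]
  refine Finset.sum_congr rfl fun y _ => ?_
  conv_rhs => rw [← Equiv.sum_comp (Equiv.addRight (scaled (1 : ZMod n) y))]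
  refine Finset.sum_congr rfl fun z _ => ?_
  have : scaled (1 : ZMod n) y + scaled (-1 : ZMod n) y = 0 := by ext i; simp [scaled]
  simp only [Equiv.coe_addRight, add_assoc, this, add_zero]
  ring

/-- The decomposition of a correlation sum along a flow. -/
theorem sum_mul_eq_flow [NeZero n] {Φ : Fin d → MvPolynomial (Fin d) ℝ}
    {p : MvPolynomial (Fin d) ℝ} (h : 1 - p ^ 2 = ∑ i, Φ i * (1 - X i)) (ω g : Torus d n → ℝ) :
    ∑ x, ω x * g x = ∑ z, polyAct (-1) p ω z * polyAct 1 p g z +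
      ∑ i, ∑ z, polyAct (-1) (Φ i) ω z * (g z - g (z + unitVec i)) := by
  -- The flow ends at p² rather than p so that one factor can be moved to ω, leaving a product of
  -- two averages.
  have e : (1 : MvPolynomial (Fin d) ℝ) = p * p + ∑ i, Φ i * (1 - X i) := by rw [← h]; ring
  have e2 : ∀ x, g x = polyAct 1 p (polyAct 1 p g) x +
      ∑ i, polyAct 1 (Φ i) (polyAct 1 (1 - X i) g) x := fun x => by
    conv_lhs => rw [← polyAct_one g x, e, polyAct_add, polyAct_sum, polyAct_mul]
    simp only [polyAct_mul]
  conv_lhs => enter [2, x]; rw [e2 x, mul_add, Finset.mul_sum]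
  rw [Finset.sum_add_distrib, sum_mul_polyAct, Finset.sum_comm]
  congr 1
  refine Finset.sum_congr rfl fun i _ => ?_
  rw [sum_mul_polyAct]
  exact Finset.sum_congr rfl fun z _ => by rw [polyAct_one_sub_X]

end Action

/-! ### Integration by parts for exchanges -/

section Exchange

variable {V : Type*} [Fintype V] [DecidableEq V]

set_option linter.unusedSectionVars false

theorem exchange_exchange (η : Config V) (x y : V) : exchange (exchange η x y) x y = η := by
  ext z; simp [exchange]

theorem bweight_exchange (r : ℝ) (η : Config V) (x y : V) :
    bweight r (exchange η x y) = bweight r η :=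
  Equiv.prod_comp (Equiv.swap x y) fun z => if η z then r else 1 - r

theorem bexp_exchange (r : ℝ) (x y : V) (g : Config V → ℝ) :
    bexp r (fun η => g (exchange η x y)) = bexp r g := by
  have : ∑ η, bweight r (exchange η x y) * g (exchange η x y) = ∑ η, bweight r η * g η :=
    Equiv.sum_comp (Function.Involutive.toPerm (fun η : Config V => exchange η x y)
      (fun η => exchange_exchange η x y)) fun η => bweight r η * g η
  simp only [bweight_exchange] at this
  exact this

theorem FreeAt.exchange {h : Config V → ℝ} {x y : V} (hx : FreeAt h x) (hy : FreeAt h y)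
    (η : Config V) : h (exchange η x y) = h η := by
  have : ReactionDiffusion.exchange η x y =
      Function.update (Function.update η x (η y)) y (η x) := by
    ext z
    by_cases h1 : z = y
    · subst h1; simp [ReactionDiffusion.exchange]
    · by_cases h2 : z = x
      · subst h2; simp [ReactionDiffusion.exchange, h1]
      · simp [ReactionDiffusion.exchange, h1, h2, Equiv.swap_apply_of_ne_of_ne]
  rw [this, hy, hx]

theorem cocc_exchange_left (r : ℝ) (η : Config V) (x y : V) :
    cocc r (exchange η x y) x = cocc r η y := by simp [cocc, occ, exchange]

theorem cocc_exchange_right (r : ℝ) (η : Config V) (x y : V) :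
    cocc r (exchange η x y) y = cocc r η x := by simp [cocc, occ, exchange]

/-- Integration by parts for the exchange dynamics. -/
theorem bexp_mul_sub_mul_le {r : ℝ} (h0 : 0 < r) (h1 : r < 1) {h f : Config V → ℝ} {x y : V}
    (hx : FreeAt h x) (hy : FreeAt h y) (hf : ∀ η, 0 < f η) {α : ℝ} (hα : 0 < α) :
    bexp r (fun η => h η * (cocc r η x - cocc r η y) * f η) ≤
      α / 2 * bexp r (fun η => (√(f (exchange η x y)) - √(f η)) ^ 2) +
        (2 * α)⁻¹ * bexp r (fun η => h η ^ 2 * f η) := by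
  have e1 := bexp_exchange r x y fun η => h η * (cocc r η x - cocc r η y) * f η
  simp only [cocc_exchange_left, cocc_exchange_right, hx.exchange hy] at e1
  have e2 := bexp_exchange r x y fun η => h η ^ 2 * f η
  simp only [hx.exchange hy] at e2
  -- The exchange changes the sign of the gradient and fixes `h`, so twice the left side is the mean
  -- of h Δ (f − f∘exchange). Factor a² − b² = (a − b)(a + b), apply Young's inequality, and use Δ²
  -- ≤ 1.
  have key : bexp r (fun η => h η * (cocc r η x - cocc r η y) * f η +
        h η * (cocc r η x - cocc r η y) * (-1 * f (exchange η x y))) ≤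
      bexp r (fun η => α * (√(f (exchange η x y)) - √(f η)) ^ 2 +
        (2 * α)⁻¹ * (h η ^ 2 * f η + h η ^ 2 * f (exchange η x y))) := by
    refine bexp_mono h0 h1 fun η => ?_
    set a := √(f η) with ha
    set b := √(f (exchange η x y)) with hb
    have ha2 : f η = a ^ 2 := (Real.sq_sqrt (hf _).le).symm
    have hb2 : f (exchange η x y) = b ^ 2 := (Real.sq_sqrt (hf _).le).symm
    rw [ha2, hb2]
    set Δ := cocc r η x - cocc r η y with hΔ
    have hΔ1 : Δ ^ 2 ≤ 1 := by
      simp only [hΔ, cocc, occ]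
      split_ifs <;> ring_nf <;> norm_num
    have s1 : h η * Δ * (a ^ 2 - b ^ 2) ≤ α * (b - a) ^ 2 + (4 * α)⁻¹ * (h η * Δ * (a + b)) ^ 2 := by
      have : 0 ≤ (4 * α)⁻¹ * (2 * α * (b - a) + h η * Δ * (a + b)) ^ 2 := by positivity
      have e : (4 * α)⁻¹ * (2 * α * (b - a) + h η * Δ * (a + b)) ^ 2 =
          α * (b - a) ^ 2 + (4 * α)⁻¹ * (h η * Δ * (a + b)) ^ 2 - h η * Δ * (a ^ 2 - b ^ 2) := by
        field_simp; ring
      linarith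
    have s2 : (h η * Δ * (a + b)) ^ 2 ≤ h η ^ 2 * (2 * (a ^ 2 + b ^ 2)) := by
      have : (a + b) ^ 2 ≤ 2 * (a ^ 2 + b ^ 2) := by nlinarith [sq_nonneg (a - b)]
      calc _ = h η ^ 2 * (Δ ^ 2 * (a + b) ^ 2) := by ring
        _ ≤ h η ^ 2 * (1 * (2 * (a ^ 2 + b ^ 2))) := by gcongr
        _ = _ := by ring
    have s3 : (4 * α)⁻¹ * (h η * Δ * (a + b)) ^ 2 ≤ (4 * α)⁻¹ * (h η ^ 2 * (2 * (a ^ 2 + b ^ 2))) := by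
      gcongr
    have e4 : (4 * α)⁻¹ * (h η ^ 2 * (2 * (a ^ 2 + b ^ 2))) =
        (2 * α)⁻¹ * (h η ^ 2 * a ^ 2 + h η ^ 2 * b ^ 2) := by field_simp; ring
    linarith
  have e5 : bexp r (fun η => h η * (cocc r η x - cocc r η y) * (-1 * f (exchange η x y))) =
      bexp r (fun η => h η * (cocc r η x - cocc r η y) * f η) := by
    rw [← e1]; congr 1; ext η; ring
  rw [bexp_add, bexp_add, e5, bexp_const_mul, bexp_const_mul, bexp_add, e2] at key
  have e6 : (2 * α)⁻¹ * (bexp r (fun η => h η ^ 2 * f η) + bexp r (fun η => h η ^ 2 * f η)) =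
      2 * ((2 * α)⁻¹ * bexp r (fun η => h η ^ 2 * f η)) := by ring
  linarith

end Exchange

/-! ### Correlation sums bounded by Dirichlet form and entropy -/

section Correlation

variable {d n : ℕ} [NeZero n]

/-- The Dirichlet form of the exclusion process at `√f`. -/
def dirichlet (r : ℝ) (f : Config (Torus d n) → ℝ) : ℝ :=
  ∑ x : Torus d n, ∑ i : Fin d,
    bexp r fun η => (√(f (exchange η x (x + unitVec i))) - √(f η)) ^ 2

theorem dvd_add_of_scaled_eq {d n : ℕ} {z : Torus d n} {y y' : Fin d →₀ ℕ}
    (h : z + scaled (-1) y = z + scaled 1 y') (k : Fin d) : n ∣ y k + y' k := by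
  have := congrFun (add_left_cancel h) k
  simp only [scaled] at this
  rw [← ZMod.natCast_eq_zero_iff]
  push_cast
  linear_combination -this

/-- The pattern sits at or behind z in direction j and the other site strictly ahead. A coincidence
would make n divide a positive number smaller than n. -/
theorem freeAt_pattern_scaled (r : ℝ) {o : Option (Fin d)} {j : Fin d} (ho : ∀ j' ∈ o, j' = j)
    {z : Torus d n} {y y' : Fin d →₀ ℕ} (h1 : 0 < y' j) (h2 : y j + y' j + 1 < n) :
    FreeAt (fun η => pattern r (-1) o η (z + scaled (-1) y)) (z + scaled 1 y') := by
  refine freeAt_pattern r _ o (fun h => ?_) fun j' hj' h => ?_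
  · have := Nat.le_of_dvd (by omega) (dvd_add_of_scaled_eq h j)
    omega
  · rw [ho j' hj', ← scaled_single, add_assoc, ← scaled_add] at h
    have := Nat.le_of_dvd (by simp) (dvd_add_of_scaled_eq h j)
    simp at this
    omega

theorem sum_coeff_avgPoly_sq_le (d M : ℕ) :
    ∑ y ∈ (avgPoly d M).support, (avgPoly d M).coeff y ^ 2 ≤ ((2 : ℝ) ^ M)⁻¹ ^ d := by
  calc _ ≤ ∑ y ∈ (avgPoly d M).support, ((2 : ℝ) ^ M)⁻¹ ^ d * (avgPoly d M).coeff y :=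
        Finset.sum_le_sum fun y _ => by
          rw [sq]
          exact mul_le_mul_of_nonneg_right (coeff_avgPoly_le d M y) (avgPoly_nonneg d M y)
    _ = _ := by rw [← Finset.mul_sum, ← mass_eq, mass_avgPoly, mul_one]

/-- The two-scale estimate of a correlation sum by Dirichlet form and entropy. -/
theorem bexp_correlation_le {r : ℝ} (h0 : 0 < r) (h1 : r < 1) {o : Option (Fin d)} {j : Fin d}
    (ho : ∀ j' ∈ o, j' = j) {M : ℕ} (hM : 2 * 2 ^ M + 2 < n) {σ : ℝ} (hσ : 0 < σ)
    (hσM : 3 * ∑ m ∈ Finset.range M, ((2 : ℝ) ^ m) ^ 2 * ((2 : ℝ) ^ m)⁻¹ ^ d ≤ σ)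
    {f : Config (Torus d n) → ℝ} (hf : ∀ η, 0 < f η) (hf1 : bexp r f = 1) {α : ℝ} (hα : 0 < α) :
    bexp r (fun η => (∑ x : Torus d n,
        pattern r (-1) o η x * cocc r η (x + unitVec j)) * f η) ≤
      α / 2 * dirichlet r f + (d * (2 * α)⁻¹ * (4 * σ) + 4 * ((2 : ℝ) ^ M)⁻¹ ^ d) *
        ((2 * ((2 * 2 ^ M : ℕ) + 1)) ^ d * dentropy r f + n ^ d) := by
  obtain ⟨Φ, -, -, hΦ3, hΦ4, hΦ5⟩ := exists_flow d M
  set Q : ℝ := (2 * (((2 * 2 ^ M : ℕ) : ℝ) + 1)) ^ d * dentropy r f + n ^ d with hQ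
  set p := avgPoly d M with hp
  have hlt : ∀ {P : MvPolynomial (Fin d) ℝ}, (∀ k, P.degreeOf k < 2 * 2 ^ M) →
      ∀ y ∈ P.support, ∀ k, y k < 2 * 2 ^ M := fun hP y hy k =>
    (MvPolynomial.degreeOf_lt_iff (by positivity)).1 (hP k) y hy
  have hpdeg : ∀ k, p.degreeOf k < 2 * 2 ^ M := fun k => by
    have : p.degreeOf k ≤ 2 ^ M - 1 := degreeOf_avgPoly_le k M
    have h2 : 0 < 2 ^ M := by positivity
    omega
  have hσ2 : (0 : ℝ) < ((2 : ℝ) ^ M)⁻¹ ^ d := by positivity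
  have hneg : (-1 : ZMod n) = 1 ∨ (-1 : ZMod n) = -1 := Or.inr rfl
  have hone : (1 : ZMod n) = 1 ∨ (1 : ZMod n) = -1 := Or.inl rfl
  let A : Fin d → Torus d n → Config (Torus d n) → ℝ := fun i z η =>
    polyAct (-1) (Φ i) (pattern r (-1) o η) z
  have hA : ∀ i, ∑ z, bexp r (fun η => A i z η ^ 2 * f η) ≤ 4 * σ * Q := fun i =>
    sum_bexp_sq_pattern_le h0 h1 hneg o (Φ i).support (fun y => (Φ i).coeff y)
      (by omega) (hlt (hΦ4 i)) hσ ((hΦ3 i _).trans hσM) hf hf1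
  have hB : ∑ z, bexp r (fun η => polyAct (-1) p (pattern r (-1) o η) z ^ 2 * f η) ≤
      4 * ((2 : ℝ) ^ M)⁻¹ ^ d * Q :=
    sum_bexp_sq_pattern_le h0 h1 hneg o p.support (fun y => p.coeff y)
      (by omega) (hlt hpdeg) hσ2 (sum_coeff_avgPoly_sq_le d M) hf hf1
  have hC : ∑ z, bexp r (fun η =>
      polyAct 1 p (fun x => cocc r η (x + unitVec j)) z ^ 2 * f η) ≤
      4 * ((2 : ℝ) ^ M)⁻¹ ^ d * Q := by
    refine le_trans (le_of_eq ?_) (sum_bexp_sq_pattern_le h0 h1 hone none p.support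
      (fun y => p.coeff y) (by omega) (hlt hpdeg) hσ2 (sum_coeff_avgPoly_sq_le d M) hf hf1)
    conv_rhs => rw [← Equiv.sum_comp (Equiv.addRight (unitVec j : Torus d n))]
    refine Finset.sum_congr rfl fun z _ => ?_
    congr 1; ext η; congr 2
    refine Finset.sum_congr rfl fun y _ => ?_
    simp only [pattern, Option.elim, one_mul, Equiv.coe_addRight, add_right_comm]
  -- The flow weight at z reads no site ahead of z in direction j, while both exchanged sites are
  -- one or two steps ahead. The condition 2 · 2^M + 2 < n excludes meeting around the torus: y_j ≤
  -- 2 · 2^M − 1, two steps ahead, and one for the second site of the pattern.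
  have hD : ∀ i z, bexp r (fun η => A i z η * (cocc r η (z + unitVec j) -
      cocc r η (z + unitVec i + unitVec j)) * f η) ≤
      α / 2 * bexp r (fun η => (√(f (exchange η (z + unitVec j)
        (z + unitVec j + unitVec i))) - √(f η)) ^ 2) +
      (2 * α)⁻¹ * bexp r (fun η => A i z η ^ 2 * f η) := by
    intro i z
    have e1 : z + unitVec j = z + scaled (1 : ZMod n) (Finsupp.single j 1) := by
      rw [scaled_single, one_smul]
    have e2 : z + unitVec j + unitVec i =
        z + scaled (1 : ZMod n) (Finsupp.single j 1 + Finsupp.single i 1) := by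
      rw [scaled_add, scaled_single, scaled_single, one_smul, one_smul, add_assoc]
    rw [add_right_comm z (unitVec i) (unitVec j)]
    refine bexp_mul_sub_mul_le h0 h1 ?_ ?_ hf hα
    · rw [e1]
      refine FreeAt.sum fun y hy => (freeAt_const _ _).mul (freeAt_pattern_scaled r ho ?_ ?_)
      · simp
      · have := hlt (hΦ4 i) y hy j
        simp; omega
    · rw [e2]
      refine FreeAt.sum fun y hy => (freeAt_const _ _).mul (freeAt_pattern_scaled r ho ?_ ?_)
      · simp
      · have := hlt (hΦ4 i) y hy j
        have h2 : (Finsupp.single i 1 : Fin d →₀ ℕ) j ≤ 1 := by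
          rw [Finsupp.single_apply]; split_ifs <;> simp
        rw [Finsupp.add_apply, Finsupp.single_eq_same]; omega
  have hsplit : bexp r (fun η => (∑ x : Torus d n,
        pattern r (-1) o η x * cocc r η (x + unitVec j)) * f η) =
      ∑ z, bexp r (fun η => polyAct (-1) p (pattern r (-1) o η) z *
        polyAct 1 p (fun x => cocc r η (x + unitVec j)) z * f η) +
      ∑ i, ∑ z, bexp r (fun η => A i z η * (cocc r η (z + unitVec j) -
        cocc r η (z + unitVec i + unitVec j)) * f η) := by
    simp only [← bexp_sum, ← bexp_add]
    congr 1; ext η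
    rw [sum_mul_eq_flow hΦ5 (pattern r (-1) o η) fun x => cocc r η (x + unitVec j), add_mul,
      Finset.sum_mul, Finset.sum_mul]
    congr 1
    exact Finset.sum_congr rfl fun i _ => Finset.sum_mul _ _ _
  have hE : ∑ z, bexp r (fun η => polyAct (-1) p (pattern r (-1) o η) z *
        polyAct 1 p (fun x => cocc r η (x + unitVec j)) z * f η) ≤
      4 * ((2 : ℝ) ^ M)⁻¹ ^ d * Q := by
    have : ∀ z, bexp r (fun η => polyAct (-1) p (pattern r (-1) o η) z *
        polyAct 1 p (fun x => cocc r η (x + unitVec j)) z * f η) ≤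
        1 / 2 * bexp r (fun η => polyAct (-1) p (pattern r (-1) o η) z ^ 2 * f η) +
        1 / 2 * bexp r (fun η => polyAct 1 p (fun x => cocc r η (x + unitVec j)) z ^ 2 * f η) := by
      intro z
      rw [← bexp_const_mul, ← bexp_const_mul, ← bexp_add]
      refine bexp_mono h0 h1 fun η => ?_
      nlinarith [mul_nonneg (sq_nonneg (polyAct (-1) p (pattern r (-1) o η) z -
        polyAct 1 p (fun x => cocc r η (x + unitVec j)) z)) (hf η).le]
    refine (Finset.sum_le_sum fun z _ => this z).trans ?_
    rw [Finset.sum_add_distrib, ← Finset.mul_sum, ← Finset.mul_sum]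
    linarith
  have hF : ∑ i, ∑ z, bexp r (fun η => A i z η * (cocc r η (z + unitVec j) -
        cocc r η (z + unitVec i + unitVec j)) * f η) ≤
      α / 2 * dirichlet r f + d * (2 * α)⁻¹ * (4 * σ) * Q := by
    refine (Finset.sum_le_sum fun i _ => Finset.sum_le_sum fun z _ => hD i z).trans ?_
    simp only [Finset.sum_add_distrib, ← Finset.mul_sum]
    refine add_le_add (le_of_eq ?_) ?_
    · congr 1
      unfold dirichlet
      rw [Finset.sum_comm]
      conv_rhs => rw [← Equiv.sum_comp (Equiv.addRight (unitVec j : Torus d n))]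
      simp
    · calc (2 * α)⁻¹ * ∑ i, ∑ z, bexp r (fun η => A i z η ^ 2 * f η) ≤
            (2 * α)⁻¹ * ∑ _i : Fin d, 4 * σ * Q := by
              refine mul_le_mul_of_nonneg_left (Finset.sum_le_sum fun i _ => hA i) (by positivity)
        _ = _ := by simp; ring
  rw [hsplit]
  linarith

end Correlation

/-! ### The mesoscopic scale and the energy of the flow -/

section Scale

theorem entropyScale_mul_sq (d n : ℕ) [NeZero n] :
    entropyScale d n * (n : ℝ) ^ 2 = (n : ℝ) ^ d * gRate d n := by
  have hn : (n : ℝ) ≠ 0 := NeZero.ne _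
  unfold entropyScale
  rw [zpow_sub₀ hn, zpow_natCast, zpow_ofNat]
  field_simp

theorem one_le_log_natCast {n : ℕ} (hn : 8 ≤ n) : 1 ≤ Real.log n := by
  have h8 : (8 : ℝ) ≤ n := by exact_mod_cast hn
  rw [Real.le_log_iff_exp_le (by linarith)]
  linarith [Real.exp_one_lt_three]

theorem one_le_gRate (d : ℕ) {n : ℕ} (hn : 8 ≤ n) : 1 ≤ gRate d n := by
  have h8 : (8 : ℝ) ≤ n := by exact_mod_cast hn
  unfold gRate
  split_ifs
  · linarith
  · exact one_le_log_natCast hn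
  · exact le_rfl

theorem gRate_le (d : ℕ) {n : ℕ} (hn : 8 ≤ n) : gRate d n ≤ n := by
  have h8 : (8 : ℝ) ≤ n := by exact_mod_cast hn
  unfold gRate
  split_ifs
  · exact le_rfl
  · exact Real.log_le_self (by linarith)
  · linarith

theorem half_le_entropyScale {d : ℕ} (hd : 1 ≤ d) (n : ℕ) [NeZero n] (h2 : d = 2 → n ≠ 1) :
    1 / 2 ≤ entropyScale d n := by
  have hn1 : 1 ≤ n := NeZero.one_le
  have hn : (1 : ℝ) ≤ n := by exact_mod_cast hn1
  unfold entropyScale gRate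
  split_ifs with h h'
  · subst h
    have hn0 : (n : ℝ) ≠ 0 := by linarith
    norm_num [hn0]
  · subst h'
    have : 2 ≤ n := by have := h2 rfl; omega
    have h3 : Real.log 2 ≤ Real.log n :=
      Real.log_le_log (by norm_num) (by exact_mod_cast this)
    have := Real.log_two_gt_d9
    norm_num
    linarith
  · have : (1 : ℝ) ≤ (n : ℝ) ^ ((d : ℤ) - 2) := one_le_zpow₀ hn (by omega)
    linarith

/-- The mesoscopic dyadic scale. -/
theorem exists_mesoscale {d n : ℕ} (hd : 1 ≤ d) (hn : 8 ^ d ≤ n) : ∃ M : ℕ,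
    8 * 2 ^ M ≤ n ∧ (8 * (2 : ℝ) ^ M) ^ d * gRate d n ≤ (n : ℝ) ^ 2 ∧
      (n : ℝ) ^ 2 ≤ (16 * (2 : ℝ) ^ M) ^ d * gRate d n := by
  have hn8 : 8 ≤ n := (Nat.le_self_pow (by omega) 8).trans hn
  have h8 : (8 : ℝ) ≤ n := by exact_mod_cast hn8
  have hg1 := one_le_gRate d hn8
  have hgn := gRate_le d hn8
  have hbound : ∀ M : ℕ, (8 * (2 : ℝ) ^ M) ^ d * gRate d n ≤ (n : ℝ) ^ 2 → 8 * 2 ^ M ≤ n := by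
    intro M hM
    have h1 : 1 ≤ 8 * (2 : ℝ) ^ M := by
      have : (1 : ℝ) ≤ 2 ^ M := one_le_pow₀ (by norm_num)
      linarith
    have : 8 * (2 : ℝ) ^ M ≤ n := by
      -- For d = 1 the factor g = n does the work; for d ≥ 2 the exponent is at least 2 and g ≥ 1
      -- suffices.
      rcases Nat.lt_or_ge d 2 with h | h
      · obtain rfl : d = 1 := by omega
        simp only [gRate, if_true, pow_one, sq] at hM
        exact le_of_mul_le_mul_right hM (by linarith)
      · refine le_of_sq_le_sq ?_ (by linarith)
        calc (8 * (2 : ℝ) ^ M) ^ 2 ≤ (8 * (2 : ℝ) ^ M) ^ d := pow_le_pow_right₀ h1 h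
          _ ≤ (8 * (2 : ℝ) ^ M) ^ d * gRate d n := le_mul_of_one_le_right (by positivity) hg1
          _ ≤ _ := hM
    exact_mod_cast this
  -- The upper bound holds at M = 0, since 8^d ≤ n and g ≤ n, and cannot hold for all M. Its last
  -- success gives ℓ; failure at 2ℓ gives the lower bound with 16.
  have hex : ∃ M : ℕ, (8 * (2 : ℝ) ^ M) ^ d * gRate d n ≤ (n : ℝ) ^ 2 ∧
      ¬ (8 * (2 : ℝ) ^ (M + 1)) ^ d * gRate d n ≤ (n : ℝ) ^ 2 := by
    by_contra! hcon
    have hall : ∀ M : ℕ, (8 * (2 : ℝ) ^ M) ^ d * gRate d n ≤ (n : ℝ) ^ 2 := by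
      intro M
      induction M with
      | zero =>
        have : (8 : ℝ) ^ d ≤ n := by exact_mod_cast hn
        rw [pow_zero, mul_one, sq]
        gcongr
      | succ M ih => exact hcon M ih
    have := hbound n (hall n)
    have := Nat.lt_two_pow_self (n := n)
    omega
  obtain ⟨M, hM1, hM2⟩ := hex
  refine ⟨M, hbound M hM1, hM1, ?_⟩
  have := (not_le.1 hM2).le
  rw [pow_succ] at this
  calc _ ≤ _ := this
    _ = _ := by congr 2; ring

/-- The m-th term is 2^{m(2−d)}: the sum is geometric and at most n for d = 1, equal to M = O(log n)
for d = 2, and bounded for d ≥ 3. This is the origin of g_d. -/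
theorem sum_scales_le {d n M : ℕ} (hd : 1 ≤ d) (hn : 8 ≤ n) (hM : 2 ^ M ≤ n) :
    3 * ∑ m ∈ Finset.range M, ((2 : ℝ) ^ m) ^ 2 * ((2 : ℝ) ^ m)⁻¹ ^ d ≤ 6 * gRate d n := by
  have h8 : (8 : ℝ) ≤ n := by exact_mod_cast hn
  have hMn : (2 : ℝ) ^ M ≤ n := by exact_mod_cast hM
  suffices h : ∑ m ∈ Finset.range M, ((2 : ℝ) ^ m) ^ 2 * ((2 : ℝ) ^ m)⁻¹ ^ d ≤ 2 * gRate d n by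
    linarith
  rcases (by omega : d = 1 ∨ d = 2 ∨ 3 ≤ d) with rfl | rfl | h3
  · have e : ∀ m ∈ Finset.range M, ((2 : ℝ) ^ m) ^ 2 * ((2 : ℝ) ^ m)⁻¹ ^ 1 = 2 ^ m := fun m _ => by
      have : (2 : ℝ) ^ m ≠ 0 := by positivity
      field_simp
    rw [Finset.sum_congr rfl e]
    have := geom_sum_mul (2 : ℝ) M
    simp only [gRate, if_true]
    linarith
  · have e : ∀ m ∈ Finset.range M, ((2 : ℝ) ^ m) ^ 2 * ((2 : ℝ) ^ m)⁻¹ ^ 2 = 1 := fun m _ => by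
      have : (2 : ℝ) ^ m ≠ 0 := by positivity
      field_simp
    rw [Finset.sum_congr rfl e]
    have h := Real.log_le_log (by positivity) hMn
    rw [Real.log_pow] at h
    have h2 := Real.log_two_gt_d9
    have hM0 : (0 : ℝ) ≤ M := by positivity
    simp [gRate]
    nlinarith
  · have e : ∀ m ∈ Finset.range M, ((2 : ℝ) ^ m) ^ 2 * ((2 : ℝ) ^ m)⁻¹ ^ d ≤ (1 / 2) ^ m :=
      fun m _ => by
        have h1 : ((2 : ℝ) ^ m)⁻¹ ^ d ≤ ((2 : ℝ) ^ m)⁻¹ ^ 3 :=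
          pow_le_pow_of_le_one (by positivity)
            (inv_le_one_of_one_le₀ (one_le_pow₀ (by norm_num))) h3
        calc _ ≤ ((2 : ℝ) ^ m) ^ 2 * ((2 : ℝ) ^ m)⁻¹ ^ 3 := by gcongr
          _ = _ := by
            have : (2 : ℝ) ^ m ≠ 0 := by positivity
            rw [one_div, inv_pow, inv_pow]
            field_simp
    refine (Finset.sum_le_sum e).trans ?_
    have hg := one_le_gRate d hn
    have := Summable.sum_le_tsum (Finset.range M) (fun i _ => by positivity)
      summable_geometric_two
    rw [tsum_geometric_two] at this
    linarith

end Scale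

/-- The two-scale estimate with α = ε n². Its error coefficients are of order g / n² and ℓ^{−d},
multiplying ℓ^d H + n^d; both products are of order H + n^{d−2} g when ℓ^d g is comparable to n². -/
theorem bexp_correlation_le_entropyScale {d n : ℕ} [NeZero n] (hd : 1 ≤ d) (hn : 8 ^ d ≤ n)
    {r : ℝ} (h0 : 0 < r) (h1 : r < 1) {o : Option (Fin d)} {j : Fin d}
    (ho : ∀ j' ∈ o, j' = j)
    {f : Config (Torus d n) → ℝ} (hf : ∀ η, 0 < f η) (hf1 : bexp r f = 1) {ε : ℝ} (hε : 0 < ε) :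
    bexp r (fun η => (∑ x : Torus d n,
        pattern r (-1) o η x * cocc r η (x + unitVec j)) * f η) ≤
      ε * n ^ 2 / 2 * dirichlet r f +
        (12 * d / ε + 4 * 16 ^ d) * (dentropy r f + entropyScale d n) := by
  obtain ⟨M, hM1, hM2, hM3⟩ := exists_mesoscale hd hn
  have hn8 : 8 ≤ n := (Nat.le_self_pow (by omega) 8).trans hn
  have hnR : (0 : ℝ) < n := by exact_mod_cast (by omega : 0 < n)
  have hg := one_le_gRate d hn8
  have h2M : 1 ≤ 2 ^ M := Nat.one_le_two_pow
  have hH := dentropy_nonneg h0 h1 hf hf1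
  have key := bexp_correlation_le h0 h1 ho (M := M) (by omega) (σ := 6 * gRate d n) (by linarith)
    (sum_scales_le hd hn8 (by omega)) hf hf1 (α := ε * n ^ 2) (by positivity)
  refine key.trans ?_
  refine add_le_add le_rfl ?_
  set l : ℝ := (2 : ℝ) ^ M with hl
  have hl1 : 1 ≤ l := one_le_pow₀ (by norm_num)
  set H := dentropy r f
  set g := gRate d n
  set S := entropyScale d n
  have hS : S * (n : ℝ) ^ 2 = (n : ℝ) ^ d * g := entropyScale_mul_sq d n
  have hbox : (2 * (((2 * 2 ^ M : ℕ) : ℝ) + 1)) ^ d ≤ (6 * l) ^ d := by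
    refine pow_le_pow_left₀ (by positivity) ?_ d
    push_cast
    rw [← hl]; linarith
  have a1 : d * (2 * (ε * (n : ℝ) ^ 2))⁻¹ * (4 * (6 * g)) = 12 * d / ε * (g / n ^ 2) := by
    field_simp; ring
  have b1 : g / (n : ℝ) ^ 2 * (6 * l) ^ d ≤ 1 := by
    rw [div_mul_eq_mul_div, div_le_one (by positivity)]
    calc g * (6 * l) ^ d ≤ g * (8 * l) ^ d := by gcongr; norm_num
      _ ≤ _ := by rw [mul_comm]; exact hM2
  have b2 : g / (n : ℝ) ^ 2 * n ^ d = S := by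
    rw [div_mul_eq_mul_div, div_eq_iff (by positivity), hS, mul_comm]
  have b3 : l⁻¹ ^ d * (6 * l) ^ d = 6 ^ d := by
    rw [← mul_pow]; congr 1; field_simp
  have b4 : l⁻¹ ^ d * (n : ℝ) ^ d ≤ 16 ^ d * S := by
    rw [← b2, ← mul_assoc]
    gcongr
    rw [inv_pow, mul_pow] at *
    rw [inv_le_iff_one_le_mul₀ (by positivity), mul_div_assoc', div_mul_eq_mul_div,
      one_le_div (by positivity)]
    linarith
  have hS0 : 0 ≤ S := by
    rw [← b2]; positivity
  calc _ ≤ (12 * d / ε * (g / n ^ 2) + 4 * l⁻¹ ^ d) * ((6 * l) ^ d * H + n ^ d) := by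
        rw [a1]; gcongr
    _ = 12 * d / ε * ((g / n ^ 2 * (6 * l) ^ d) * H + g / n ^ 2 * n ^ d) +
        4 * ((l⁻¹ ^ d * (6 * l) ^ d) * H + l⁻¹ ^ d * n ^ d) := by ring
    _ ≤ 12 * d / ε * (1 * H + S) + 4 * (16 ^ d * H + 16 ^ d * S) := by
        rw [b2, b3]; gcongr; norm_num
    _ = _ := by ring

/-! ### The forcing term as a polynomial -/

section Forcing

theorem bernoulliProduct_real_cylinder {V : Type*} (m : unitInterval) (s : Finset V)
    (b : V → Bool) : (bernoulliProduct V m).real {η | ∀ x ∈ s, η x = b x} =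
      ∏ x ∈ s, if b x then (m : ℝ) else 1 - m := by
  have e : {η : Config V | ∀ x ∈ s, η x = b x} = Set.pi s fun x => {b x} := by
    ext η; simp [Set.mem_pi]
  rw [e, bernoulliProduct, measureReal_def,
    Measure.infinitePi_pi _ fun x _ => measurableSet_singleton _, ENNReal.toReal_prod]
  refine Finset.prod_congr rfl fun x _ => ?_
  rw [← measureReal_def]
  cases b x <;> simp

theorem integral_cylinder {V : Type*} (m : unitInterval) (s : Finset V) (b : V → Bool) :
    Integrable (Set.indicator {η : Config V | ∀ x ∈ s, η x = b x} (1 : Config V → ℝ))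
      (bernoulliProduct V m) ∧
    ∫ η, Set.indicator {η : Config V | ∀ x ∈ s, η x = b x} (1 : Config V → ℝ) η
      ∂(bernoulliProduct V m) = ∏ x ∈ s, if b x then (m : ℝ) else 1 - m := by
  have hm : MeasurableSet {η : Config V | ∀ x ∈ s, η x = b x} := by
    have e : {η : Config V | ∀ x ∈ s, η x = b x} = ⋂ x ∈ s, (fun η => η x) ⁻¹' {b x} := by
      ext η; simp
    rw [e]
    exact Finset.measurableSet_biInter s fun x _ =>
      (measurable_pi_apply x) (measurableSet_singleton _)
  have : IsProbabilityMeasure (bernoulliProduct V m) := by unfold bernoulliProduct; infer_instance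
  refine ⟨(integrable_const (1 : ℝ)).indicator hm, ?_⟩
  rw [integral_indicator_one hm, bernoulliProduct_real_cylinder]

/-- The sites −e_j, 0, e_j are distinct in ℤ^d, so the integrand is a combination of cylinder
indicators of independent variables. -/
theorem forcing_eq (d : ℕ) (lam : ℝ) (m : unitInterval) :
    forcing d lam m = (1 - m) * (1 + lam * (d * (m : ℝ) ^ 2)) - m := by
  classical
  let I0 : Config (Fin d → ℤ) → ℝ :=
    Set.indicator {η : Config (Fin d → ℤ) | ∀ x ∈ ({0} : Finset (Fin d → ℤ)), η x = (fun _ => false) x} 1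
  let J : Fin d → Config (Fin d → ℤ) → ℝ := fun j =>
    Set.indicator {η : Config (Fin d → ℤ) | ∀ x ∈ ({0, -unitVec j, unitVec j} : Finset (Fin d → ℤ)),
      η x = (fun x => if x = 0 then false else true) x} 1
  have h0 := integral_cylinder m ({0} : Finset (Fin d → ℤ)) fun _ => false
  have hJ := fun j : Fin d => integral_cylinder m ({0, -unitVec j, unitVec j} : Finset (Fin d → ℤ))
    fun x => if x = 0 then false else true
  have hne : ∀ j : Fin d, (unitVec j : (Fin d → ℤ)) ≠ 0 := fun j h => by
    have := congrFun h j
    simp [unitVec] at this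
  have hne2 : ∀ j : Fin d, (-unitVec j : (Fin d → ℤ)) ≠ unitVec j := fun j h => by
    have := congrFun h j
    simp [unitVec] at this
  have hprod : ∀ j : Fin d, ∏ x ∈ ({0, -unitVec j, unitVec j} : Finset (Fin d → ℤ)),
      (if (if x = 0 then false else true) = true then (m : ℝ) else 1 - m) = (1 - m) * m ^ 2 := by
    intro j
    rw [Finset.prod_insert, Finset.prod_pair (hne2 j)]
    · simp [hne j, sq]
    · simp [(hne j).symm, Ne.symm (neg_ne_zero.2 (hne j))]
  have hfun : ∀ η : Config (Fin d → ℤ), (1 - occ η 0) * birthRate lam η 0 - occ η 0 * deathRate η 0 =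
      2 * I0 η - 1 + lam * ∑ j, J j η := by
    intro η
    have hI : I0 η = 1 - occ η 0 := by
      simp only [I0, Set.indicator_apply, occ]
      cases h : η 0 <;> simp [h]
    have hJ' : ∀ j, J j η = (1 - occ η 0) * (occ η (0 - unitVec j) * occ η (0 + unitVec j)) := by
      intro j
      simp only [J, Set.indicator_apply, occ, zero_sub, zero_add]
      cases h : η 0 <;> cases h1 : η (-unitVec j) <;> cases h2 : η (unitVec j) <;>
        simp [h, h1, h2, hne j]
    simp only [hI, hJ', birthRate, deathRate, ← Finset.mul_sum]
    ring
  unfold forcing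
  simp only [hfun]
  have : IsProbabilityMeasure (bernoulliProduct (Fin d → ℤ) m) := by unfold bernoulliProduct; infer_instance
  rw [integral_add, integral_sub, integral_const_mul, integral_const_mul, integral_finsetSum]
  · have e0 : ∫ η, I0 η ∂(bernoulliProduct (Fin d → ℤ) m) = 1 - m := by
      exact h0.2.trans (by simp)
    have eJ : ∀ j, ∫ η, J j η ∂(bernoulliProduct (Fin d → ℤ) m) = (1 - m) * m ^ 2 := fun j =>
      (hJ j).2.trans (hprod j)
    rw [e0, Finset.sum_congr rfl fun j _ => eJ j]
    simp
    ring
  · exact fun j _ => (hJ j).1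
  · exact h0.1.const_mul 2
  · exact integrable_const 1
  · exact (h0.1.const_mul 2).sub (integrable_const 1)
  · exact (integrable_finsetSum _ fun j _ => (hJ j).1).const_mul lam

end Forcing

/-! ### The reaction part and its adjoint -/

section Reaction

variable {d n : ℕ} [NeZero n]

theorem unitVec_ne_zero {d n : ℕ} (hn : 2 ≤ n) (j : Fin d) : (unitVec j : Torus d n) ≠ 0 := fun h => by
  have := congrFun h j
  have : Fact (1 < n) := ⟨hn⟩
  simp [unitVec] at *

theorem occ_flip_of_ne {V : Type*} [DecidableEq V] (η : Config V) {x y : V} (h : y ≠ x) :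
    occ (flip η x) y = occ η y := by simp [occ, flip, h]

/-- For n ≥ 2 the sites x ± e_j differ from x; on the one-point torus they would coincide with it.
-/
theorem birthRate_flip {d n : ℕ} (hn : 2 ≤ n) (lam : ℝ) (η : Config (Torus d n)) (x : Torus d n) :
    birthRate lam (flip η x) x = birthRate lam η x := by
  unfold birthRate
  congr 2
  refine Finset.sum_congr rfl fun j _ => ?_
  have h := unitVec_ne_zero hn j
  rw [occ_flip_of_ne _ (by simpa using h), occ_flip_of_ne _ (by simpa using h)]

theorem bweight_flip_mul {V : Type*} [Fintype V] [DecidableEq V] (r : ℝ) (η : Config V) (x : V) :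
    bweight r (flip η x) * (if η x then r else 1 - r) =
      bweight r η * (if η x then 1 - r else r) := by
  have h1 := bweight_update r η x (η x)
  have h2 := bweight_update r η x (!(η x))
  rw [Function.update_eq_self] at h1
  unfold flip
  rw [h1, h2]
  cases η x <;> simp <;> ring

theorem flipRate_bounds {d n : ℕ} {lam : ℝ} (hlam : 0 < lam) (η : Config (Torus d n)) (x : Torus d n) :
    1 ≤ flipRate lam η x ∧ flipRate lam η x ≤ 1 + lam * d := by
  have h1 : 0 ≤ ∑ j : Fin d, occ η (x - unitVec j) * occ η (x + unitVec j) :=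
    Finset.sum_nonneg fun j _ => by unfold occ; split_ifs <;> norm_num
  have h2 : ∑ j : Fin d, occ η (x - unitVec j) * occ η (x + unitVec j) ≤ d := by
    calc _ ≤ ∑ _j : Fin d, (1 : ℝ) :=
          Finset.sum_le_sum fun j _ => by unfold occ; split_ifs <;> norm_num
      _ = d := by simp
  have h3 : 0 ≤ lam * ∑ j : Fin d, occ η (x - unitVec j) * occ η (x + unitVec j) := by positivity
  have h4 : lam * ∑ j : Fin d, occ η (x - unitVec j) * occ η (x + unitVec j) ≤ lam * d := by gcongr
  have h5 : 0 ≤ lam * d := by positivity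
  unfold flipRate birthRate deathRate
  rcases (by unfold occ; split_ifs <;> simp : occ η x = 0 ∨ occ η x = 1) with h | h <;>
    rw [h] <;> constructor <;> linarith

theorem bexp_comp_flip {V : Type*} [Fintype V] [DecidableEq V] (r : ℝ) (x : V)
    (c f : Config V → ℝ) :
    bexp r (fun η => c η * f (flip η x)) = ∑ η, bweight r (flip η x) * (c (flip η x) * f η) := by
  rw [← sum_flip x]
  simp [flip_flip, bexp]

/-- The crude bound on the reaction part of the entropy production. -/
theorem bexp_reactionGenerator_le {r : ℝ} (h0 : 0 < r) (h1 : r < 1) {lam : ℝ} (hlam : 0 < lam)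
    {f : Config (Torus d n) → ℝ} (hf : ∀ η, 0 < f η) (hf1 : bexp r f = 1) :
    bexp r (reactionGenerator d n lam f) ≤ (1 + lam * d) * (r * (1 - r))⁻¹ * n ^ d := by
  have hx : ∀ x : Torus d n, bexp r (fun η => flipRate lam η x * (f (flip η x) - f η)) ≤
      (1 + lam * d) * (r * (1 - r))⁻¹ := by
    intro x
    have hr : 0 < r * (1 - r) := mul_pos h0 (by linarith)
    calc bexp r (fun η => flipRate lam η x * (f (flip η x) - f η)) ≤
          bexp r (fun η => (1 + lam * d) * f (flip η x)) := bexp_mono h0 h1 fun η => by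
            have hc := flipRate_bounds hlam η x
            have a := mul_le_mul_of_nonneg_right hc.2 (hf (flip η x)).le
            have b := mul_nonneg (zero_le_one.trans hc.1) (hf η).le
            linarith
      _ = ∑ η, bweight r (flip η x) * ((1 + lam * d) * f η) :=
            bexp_comp_flip r x (fun _ => 1 + lam * d) f
      -- A flip changes the weight by a factor r / (1 − r) or its inverse, both at most 1 / (r (1 −
      -- r)).
      _ ≤ ∑ η, (r * (1 - r))⁻¹ * bweight r η * ((1 + lam * d) * f η) := by
            refine Finset.sum_le_sum fun η _ => mul_le_mul_of_nonneg_right ?_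
              (mul_nonneg (by positivity) (hf η).le)
            rw [← div_eq_inv_mul, le_div_iff₀ hr]
            have e := bweight_flip_mul r η x
            have w1 := bweight_pos h0 h1 η
            have w2 := bweight_pos h0 h1 (flip η x)
            split_ifs at e <;> nlinarith
      _ = (1 + lam * d) * (r * (1 - r))⁻¹ * bexp r f := by
            unfold bexp; rw [Finset.mul_sum]
            exact Finset.sum_congr rfl fun η _ => by ring
      _ = _ := by rw [hf1, mul_one]
  have e : bexp r (reactionGenerator d n lam f) =
      ∑ x : Torus d n, bexp r (fun η => flipRate lam η x * (f (flip η x) - f η)) := by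
    rw [← bexp_sum]; rfl
  rw [e]
  refine (Finset.sum_le_sum fun x _ => hx x).trans (le_of_eq ?_)
  simp [ZMod.card]; ring

/-- The adjoint of the reaction generator applied to the constant function. -/
theorem bexp_reactionGenerator_eq (hn : 2 ≤ n) {r : ℝ} (h0 : 0 < r) (h1 : r < 1) {lam : ℝ}
    (hF : (1 - r) * (1 + lam * (d * r ^ 2)) - r = 0) (f : Config (Torus d n) → ℝ) :
    bexp r (reactionGenerator d n lam f) = lam / r * ∑ j : Fin d,
      (bexp r (fun η => (∑ x : Torus d n,
        pattern r (-1) (some j) η x * cocc r η (x + unitVec j)) * f η) +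
      2 * r * bexp r (fun η => (∑ x : Torus d n,
        pattern r (-1) none η x * cocc r η (x + unitVec j)) * f η)) := by
  have hr1 : 1 - r ≠ 0 := by linarith
  -- Change variables in the gain term. With the birth rate written as its mean 1 + λ d r² plus λ Y,
  -- the relation F(r) = 0 cancels the part proportional to η̄_x and leaves (λ / r) η̄_x Y.
  have hx : ∀ x : Torus d n, bexp r (fun η => flipRate lam η x * (f (flip η x) - f η)) =
      bexp r (fun η => lam / r * (∑ j : Fin d,
        cocc r η x * (occ η (x - unitVec j) * occ η (x + unitVec j) - r ^ 2)) * f η) := by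
    intro x
    have e1 : bexp r (fun η => flipRate lam η x * (f (flip η x) - f η)) =
        bexp r (fun η => flipRate lam η x * f (flip η x)) +
        bexp r (fun η => -1 * (flipRate lam η x * f η)) := by
      rw [← bexp_add]; congr 1; ext η; ring
    rw [e1, bexp_comp_flip r x (fun η => flipRate lam η x) f]
    unfold bexp
    rw [← Finset.sum_add_distrib]
    refine Finset.sum_congr rfl fun η _ => ?_
    dsimp only
    have hw := bweight_flip_mul r η x
    have hb : birthRate lam η x = 1 + lam * ((∑ j : Fin d,
        (occ η (x - unitVec j) * occ η (x + unitVec j) - r ^ 2)) + d * r ^ 2) := by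
      simp [birthRate]
    rw [← Finset.mul_sum]
    set Y := ∑ j : Fin d, (occ η (x - unitVec j) * occ η (x + unitVec j) - r ^ 2)
    simp only [flipRate, birthRate_flip hn, deathRate, hb]
    cases hη : η x
    · have o1 : occ η x = 0 := by simp [occ, hη]
      have o2 : occ (flip η x) x = 1 := by simp [occ, flip, hη]
      rw [hη] at hw
      simp only [Bool.false_eq_true, if_false] at hw
      have hw' : bweight r (flip η x) = bweight r η * r / (1 - r) := by
        rw [eq_div_iff hr1, hw]
      rw [o1, o2, hw', cocc, o1]
      field_simp
      linear_combination (-r * bweight r η * f η) * hF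
    · have o1 : occ η x = 1 := by simp [occ, hη]
      have o2 : occ (flip η x) x = 0 := by simp [occ, flip, hη]
      rw [hη] at hw
      simp only [if_true] at hw
      have hw' : bweight r (flip η x) = bweight r η * (1 - r) / r := by
        rw [eq_div_iff h0.ne', hw]
      rw [o1, o2, hw', cocc, o1]
      field_simp
      linear_combination (bweight r η * f η) * hF
  have e : bexp r (reactionGenerator d n lam f) =
      ∑ x : Torus d n, bexp r (fun η => flipRate lam η x * (f (flip η x) - f η)) := by
    rw [← bexp_sum]; rfl
  rw [e, Finset.sum_congr rfl fun x _ => hx x, ← bexp_sum, Finset.mul_sum]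
  simp only [← bexp_const_mul, ← bexp_add, ← bexp_sum]
  congr 1; ext η
  rw [← Finset.sum_mul, ← Finset.mul_sum, Finset.sum_comm, Finset.mul_sum, Finset.sum_mul]
  refine Finset.sum_congr rfl fun j _ => ?_
  have hshift : ∑ x : Torus d n, cocc r η x * cocc r η (x - unitVec j) =
      ∑ x : Torus d n, cocc r η x * cocc r η (x + unitVec j) := by
    rw [← Equiv.sum_comp (Equiv.addRight (unitVec j : Torus d n))]
    refine Finset.sum_congr rfl fun x _ => ?_
    simp [mul_comm]
  -- Centring gives a b − r² = ā b̄ + r ā + r b̄; the two pair sums agree after a shift, whence 2r.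
  have hexp : ∑ x : Torus d n,
      cocc r η x * (occ η (x - unitVec j) * occ η (x + unitVec j) - r ^ 2) =
      ∑ x : Torus d n, pattern r (-1) (some j) η x * cocc r η (x + unitVec j) +
      2 * r * ∑ x : Torus d n, pattern r (-1) none η x * cocc r η (x + unitVec j) := by
    have : ∀ x : Torus d n,
        cocc r η x * (occ η (x - unitVec j) * occ η (x + unitVec j) - r ^ 2) =
        pattern r (-1) (some j) η x * cocc r η (x + unitVec j) +
        r * (cocc r η x * cocc r η (x - unitVec j)) +
        r * (cocc r η x * cocc r η (x + unitVec j)) := fun x => by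
      have ex : x + (-1 : ZMod n) • (unitVec j : Torus d n) = x - unitVec j := by
        rw [neg_one_smul, sub_eq_add_neg]
      simp only [pattern, Option.elim, ex]
      unfold cocc
      ring
    rw [Finset.sum_congr rfl fun x _ => this x, Finset.sum_add_distrib, Finset.sum_add_distrib,
      ← Finset.mul_sum, ← Finset.mul_sum, hshift]
    simp only [pattern, Option.elim, one_mul]
    ring
  rw [hexp]; ring

end Reaction

/-! ### Entropy production -/

section Production

variable {d n : ℕ} [NeZero n]

/-- Use log u ≤ u − 1 at u = √(b / a) rather than b / a: this retains the square that becomes the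
Dirichlet form. -/
theorem mul_log_sub_log_le {a b : ℝ} (ha : 0 < a) (hb : 0 < b) :
    a * (Real.log b - Real.log a) ≤ b - a - (√b - √a) ^ 2 := by
  have sa := Real.sqrt_pos.2 ha
  have sb := Real.sqrt_pos.2 hb
  have ea := Real.sq_sqrt ha.le
  have eb := Real.sq_sqrt hb.le
  have h := Real.log_le_sub_one_of_pos (div_pos sb sa)
  rw [Real.log_div sb.ne' sa.ne', Real.log_sqrt hb.le, Real.log_sqrt ha.le] at h
  have h2 : Real.log b - Real.log a ≤ 2 * (√b / √a - 1) := by linarith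
  calc a * (Real.log b - Real.log a) ≤ a * (2 * (√b / √a - 1)) := by gcongr
    _ = 2 * √a * √b - 2 * √a ^ 2 := by
        conv_lhs => rw [← ea]
        rw [Real.sqrt_sq sa.le]
        field_simp
    _ = _ := by nlinarith

theorem bexp_exclusionGenerator (r : ℝ) (f : Config (Torus d n) → ℝ) :
    bexp r (exclusionGenerator d n f) = 0 := by
  have : bexp r (exclusionGenerator d n f) = ∑ x : Torus d n, ∑ j : Fin d,
      (bexp r (fun η => f (exchange η x (x + unitVec j))) + bexp r (fun η => -1 * f η)) := by
    simp only [← bexp_sum, ← bexp_add]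
    congr 1; ext η
    simp [exclusionGenerator, sub_eq_add_neg]
  rw [this]
  refine Finset.sum_eq_zero fun x _ => Finset.sum_eq_zero fun j _ => ?_
  rw [bexp_exchange, bexp_const_mul]; ring

/-- Entropy production is bounded by minus the Dirichlet form plus the reaction term. -/
theorem bexp_mul_generator_log_le {r : ℝ} (h0 : 0 < r) (h1 : r < 1) {lam : ℝ} (hlam : 0 < lam)
    {f : Config (Torus d n) → ℝ} (hf : ∀ η, 0 < f η) :
    bexp r (fun η => f η * generator d n lam (fun ξ => Real.log (f ξ)) η) ≤
      -(n ^ 2 * dirichlet r f) + bexp r (reactionGenerator d n lam f) := by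
  have key : bexp r (fun η => f η * generator d n lam (fun ξ => Real.log (f ξ)) η) ≤
      bexp r (fun η => (n : ℝ) ^ 2 * (exclusionGenerator d n f η + -1 * ∑ x : Torus d n,
        ∑ i : Fin d, (√(f (exchange η x (x + unitVec i))) - √(f η)) ^ 2) +
        reactionGenerator d n lam f η) := by
    refine bexp_mono h0 h1 fun η => ?_
    unfold generator exclusionGenerator reactionGenerator
    rw [mul_add, mul_left_comm, Finset.mul_sum]
    gcongr ?_ * ?_ + ?_
    · rw [neg_one_mul, ← sub_eq_add_neg, ← Finset.sum_sub_distrib]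
      refine Finset.sum_le_sum fun x _ => ?_
      rw [Finset.mul_sum, ← Finset.sum_sub_distrib]
      exact Finset.sum_le_sum fun i _ => mul_log_sub_log_le (hf _) (hf _)
    · rw [Finset.mul_sum]
      refine Finset.sum_le_sum fun x _ => ?_
      rw [mul_left_comm]
      refine mul_le_mul_of_nonneg_left ?_ (zero_le_one.trans (flipRate_bounds hlam η x).1)
      have := mul_log_sub_log_le (hf η) (hf (flip η x))
      have := sq_nonneg (√(f (flip η x)) - √(f η))
      linarith
  refine key.trans (le_of_eq ?_)
  rw [bexp_add, bexp_const_mul, bexp_add, bexp_const_mul, bexp_exclusionGenerator, bexp_sum]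
  simp only [bexp_sum]
  unfold dirichlet
  ring

theorem dirichlet_nonneg {r : ℝ} (h0 : 0 < r) (h1 : r < 1) (f : Config (Torus d n) → ℝ) :
    0 ≤ dirichlet r f :=
  Finset.sum_nonneg fun _ _ => Finset.sum_nonneg fun _ _ =>
    bexp_nonneg h0 h1 fun _ => sq_nonneg _

/-- The entropy production is at most a constant times entropy plus the entropy scale. -/
theorem exists_entropyProduction_le {d : ℕ} (hd : 1 ≤ d) {lam : ℝ} (hlam : 0 < lam) {r : ℝ}
    (h0 : 0 < r) (h1 : r < 1) (hF : (1 - r) * (1 + lam * (d * r ^ 2)) - r = 0) :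
    ∃ C : ℝ, 0 < C ∧ ∀ (n : ℕ) [NeZero n], (d = 2 → n ≠ 1) →
      ∀ f : Config (Torus d n) → ℝ, (∀ η, 0 < f η) → bexp r f = 1 →
      bexp r (fun η => f η * generator d n lam (fun ξ => Real.log (f ξ)) η) ≤
        C * (dentropy r f + entropyScale d n) := by
  have hd0 : (0 : ℝ) < d := by exact_mod_cast hd
  have hr : 0 < r * (1 - r) := mul_pos h0 (by linarith)
  -- Chosen so that (λ / r) · d · 3 · ε / 2 = 1 / 2: the correlation terms use half of n² D. The 3
  -- bounds 1 + 2r.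
  set ε : ℝ := r / (3 * lam * d) with hε
  have hε0 : 0 < ε := by positivity
  set B : ℝ := 12 * d / ε + 4 * 16 ^ d with hB
  have hB0 : 0 < B := by positivity
  -- For n < 8^d the crude bound is enough; the factor 2 compensates for the scale being only at
  -- least 1 / 2.
  set C₁ : ℝ := 2 * ((1 + lam * d) * (r * (1 - r))⁻¹ * (8 ^ d) ^ d) with hC₁
  have hC₁0 : 0 < C₁ := by positivity
  set C₂ : ℝ := lam / r * (d * (3 * B)) with hC₂
  have hC₂0 : 0 < C₂ := by positivity
  refine ⟨C₁ + C₂, by positivity, fun n _ hn2 f hf hf1 => ?_⟩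
  have hS := half_le_entropyScale hd n hn2
  have hH := dentropy_nonneg h0 h1 hf hf1
  have hD := dirichlet_nonneg h0 h1 f
  refine (bexp_mul_generator_log_le h0 h1 hlam hf).trans ?_
  rcases Nat.lt_or_ge n (8 ^ d) with hn | hn
  · have a := bexp_reactionGenerator_le h0 h1 hlam hf hf1 (d := d) (n := n)
    have b : (1 + lam * d) * (r * (1 - r))⁻¹ * (n : ℝ) ^ d ≤
        (1 + lam * d) * (r * (1 - r))⁻¹ * (8 ^ d) ^ d := by
      gcongr
      exact_mod_cast hn.le
    have c : C₁ * (1 / 2) ≤ (C₁ + C₂) * (dentropy r f + entropyScale d n) := by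
      gcongr <;> linarith
    have e : 0 ≤ (n : ℝ) ^ 2 * dirichlet r f := by positivity
    linarith
  · have hn8 : 8 ≤ n := (Nat.le_self_pow (by omega) 8).trans hn
    rw [bexp_reactionGenerator_eq (by omega) h0 h1 hF]
    have hj : ∀ j : Fin d, bexp r (fun η => (∑ x : Torus d n,
        pattern r (-1) (some j) η x * cocc r η (x + unitVec j)) * f η) +
      2 * r * bexp r (fun η => (∑ x : Torus d n,
        pattern r (-1) none η x * cocc r η (x + unitVec j)) * f η) ≤
        3 * (ε * n ^ 2 / 2 * dirichlet r f + B * (dentropy r f + entropyScale d n)) := by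
      intro j
      have a := bexp_correlation_le_entropyScale hd hn h0 h1 (o := some j) (j := j)
        (fun j' h => by simpa using h.symm) hf hf1 hε0
      have b := bexp_correlation_le_entropyScale hd hn h0 h1 (o := none) (j := j)
        (fun j' h => by simp at h) hf hf1 hε0
      have c : 0 ≤ ε * n ^ 2 / 2 * dirichlet r f + B * (dentropy r f + entropyScale d n) := by
        have : 0 ≤ dentropy r f + entropyScale d n := by linarith
        positivity
      have b' := mul_le_mul_of_nonneg_left b (by linarith : 0 ≤ 2 * r)
      have c' := mul_le_mul_of_nonneg_right (by linarith : 2 * r ≤ 2) c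
      linarith
    have hsum := Finset.sum_le_sum fun j (_ : j ∈ (Finset.univ : Finset (Fin d))) => hj j
    rw [Finset.sum_const, Finset.card_univ, Fintype.card_fin, nsmul_eq_mul] at hsum
    have h3 := mul_le_mul_of_nonneg_left hsum (by positivity : 0 ≤ lam / r)
    have e : lam / r * (d * (3 * (ε * n ^ 2 / 2 * dirichlet r f +
        B * (dentropy r f + entropyScale d n)))) =
        n ^ 2 * dirichlet r f / 2 + C₂ * (dentropy r f + entropyScale d n) := by
      rw [hC₂, hε]; field_simp
    have h4 : 0 ≤ C₁ * (dentropy r f + entropyScale d n) := by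
      have : 0 ≤ dentropy r f + entropyScale d n := by linarith
      positivity
    have h5 : 0 ≤ (n : ℝ) ^ 2 * dirichlet r f := by positivity
    linarith

end Production

/-! ### Finite-state Markov processes and the forward equation -/

section Markov

variable {S : Type*} [Fintype S] [DecidableEq S]

open scoped Matrix.Norms.Operator in
theorem hasDerivAt_transition (L : (S → ℝ) → S → ℝ) (a b : S) (t : ℝ) :
    HasDerivAt (fun t => transition L t a b)
      (∑ c, transition L t a c * generatorMatrix L c b) t := by
  have h := hasDerivAt_exp_smul_const (𝕂 := ℝ) (generatorMatrix L) t
  have h2 := (hasDerivAt_pi.1 ((hasDerivAt_pi.1 h) a)) b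
  exact h2

variable [MeasurableSpace S] [MeasurableSingletonClass S] {Ω : Type*} [MeasurableSpace Ω]
  {L : (S → ℝ) → S → ℝ} {P : Measure Ω} [IsProbabilityMeasure P] {X : ℝ → Ω → S}

/-- The law at time `t` of the chain with generator `L` started from the law of `X 0`. -/
def lawAt (L : (S → ℝ) → S → ℝ) (P : Measure Ω) (X : ℝ → Ω → S) (t : ℝ) (b : S) : ℝ :=
  ∑ a, P.real {ω | X 0 ω = a} * transition L t a b

set_option linter.unusedSectionVars false

/-- Kolmogorov's forward equation. `lawAt` involves only the initial law and the matrix exponential,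
so it is smooth on all of ℝ, while `X` is controlled only for t ≥ 0. -/
theorem hasDerivAt_lawAt (L : (S → ℝ) → S → ℝ) (P : Measure Ω) (X : ℝ → Ω → S) (b : S) (t : ℝ) :
    HasDerivAt (fun t => lawAt L P X t b) (∑ c, lawAt L P X t c * generatorMatrix L c b) t := by
  have : ∑ c, lawAt L P X t c * generatorMatrix L c b =
      ∑ a, P.real {ω | X 0 ω = a} * ∑ c, transition L t a c * generatorMatrix L c b := by
    simp only [lawAt, Finset.sum_mul, Finset.mul_sum]
    rw [Finset.sum_comm]
    simp only [mul_assoc]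
  rw [this]
  exact HasDerivAt.fun_sum fun a _ => (hasDerivAt_transition L a b t).const_mul _

theorem IsMarkovProcess.real_eq_lawAt (hX : IsMarkovProcess L P X) {t : ℝ} (ht : 0 ≤ t) (b : S) :
    (P.map (X t)).real {b} = lawAt L P X t b := by
  rw [map_measureReal_apply (hX.measurable t ht) (measurableSet_singleton b)]
  -- The joint law at times 0 and t, to be summed over the initial state.
  have hk : ∀ a, P.real ({ω | X 0 ω = a} ∩ X t ⁻¹' {b}) =
      P.real {ω | X 0 ω = a} * transition L t a b := fun a => by
    have := hX.finDimDistr 1 ![0, t] le_rfl (by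
      intro i j hij
      fin_cases i <;> fin_cases j <;> simp_all) ![a, b]
    have e : X t ⁻¹' {b} = {ω | X t ω = b} := by ext; simp
    rw [e]
    simpa [Set.ofPred_and] using this
  unfold lawAt
  rw [← Finset.sum_congr rfl fun a _ => hk a]
  rw [← measureReal_biUnion_finset]
  · congr 1
    ext ω; simp
  · intro a _ a' _ hne
    refine Set.disjoint_left.2 fun ω h h' => hne ?_
    exact h.1.symm.trans h'.1
  · intro a _
    exact ((hX.measurable 0 le_rfl) (measurableSet_singleton a)).inter
      ((hX.measurable t ht) (measurableSet_singleton b))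

theorem IsMarkovProcess.lawAt_nonneg (hX : IsMarkovProcess L P X) {t : ℝ} (ht : 0 ≤ t) (b : S) :
    0 ≤ lawAt L P X t b := by
  rw [← hX.real_eq_lawAt ht]; exact measureReal_nonneg

theorem IsMarkovProcess.sum_lawAt (hX : IsMarkovProcess L P X) {t : ℝ} (ht : 0 ≤ t) :
    ∑ b, lawAt L P X t b = 1 := by
  have : IsProbabilityMeasure (P.map (X t)) :=
    Measure.isProbabilityMeasure_map (hX.measurable t ht).aemeasurable
  simp only [← hX.real_eq_lawAt ht]
  rw [sum_measureReal_singleton]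
  simp

/-- If a state has mass zero at a positive time, so has every state from which it can be reached in
one jump. -/
theorem IsMarkovProcess.lawAt_eq_zero_of_rate_pos (hX : IsMarkovProcess L P X)
    (hL : ∀ a b, a ≠ b → 0 ≤ generatorMatrix L a b) {t : ℝ} (ht : 0 < t) {a b : S}
    (hab : 0 < generatorMatrix L a b) (hb : lawAt L P X t b = 0) :
    lawAt L P X t a = 0 := by
  -- A zero at t > 0 is an interior minimum in time, so the derivative vanishes. By the forward
  -- equation this derivative is a sum of nonnegative inflows, each of which must then be zero.
  have hmin : IsLocalMin (fun s => lawAt L P X s b) t := by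
    filter_upwards [lt_mem_nhds ht] with s hs
    rw [hb]; exact hX.lawAt_nonneg hs.le b
  have hd := hmin.hasDerivAt_eq_zero (hasDerivAt_lawAt L P X b t)
  have hterm : ∀ c ∈ Finset.univ, 0 ≤ lawAt L P X t c * generatorMatrix L c b := fun c _ => by
    by_cases h : c = b
    · rw [h, hb, zero_mul]
    · exact mul_nonneg (hX.lawAt_nonneg ht.le c) (hL c b h)
  have := (Finset.sum_eq_zero_iff_of_nonneg hterm).1 hd a (Finset.mem_univ a)
  exact (mul_eq_zero.1 this).resolve_right hab.ne'

end Markov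

/-! ### Positivity of the law and the derivative of the entropy -/

section Generator

variable {d n : ℕ} [NeZero n]

theorem generator_eq_sum (lam : ℝ) (f : Config (Torus d n) → ℝ) (η : Config (Torus d n)) :
    generator d n lam f η = ∑ ξ, generatorMatrix (generator d n lam) η ξ * f ξ := by
  have hlin : IsLinearMap ℝ (generator d n lam) := by
    constructor
    · intro f g
      ext η
      simp only [generator, exclusionGenerator, reactionGenerator, Pi.add_apply]
      have e1 : ∀ x y : Torus d n, ∀ f g : Config (Torus d n) → ℝ,
        f (exchange η x y) + g (exchange η x y) - (f η + g η) =
        (f (exchange η x y) - f η) + (g (exchange η x y) - g η) := fun _ _ _ _ => by ring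
      have e2 : ∀ x : Torus d n, flipRate lam η x * (f (flip η x) + g (flip η x) - (f η + g η)) =
        flipRate lam η x * (f (flip η x) - f η) + flipRate lam η x * (g (flip η x) - g η) :=
        fun _ => by ring
      simp only [e1, e2, Finset.sum_add_distrib]
      ring
    · intro c f
      ext η
      simp only [generator, exclusionGenerator, reactionGenerator, Pi.smul_apply, smul_eq_mul,
        ← mul_sub, mul_left_comm _ c, ← Finset.mul_sum]
      ring
  have hf' : f = ∑ ξ, f ξ • (Pi.single ξ 1 : Config (Torus d n) → ℝ) := by
    ext ζ
    simp [Pi.single_apply]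
  have : generator d n lam f = ∑ ξ, f ξ • generator d n lam (Pi.single ξ 1) := by
    conv_lhs => rw [hf', ← IsLinearMap.mk'_apply hlin]
    rw [map_sum]
    exact Finset.sum_congr rfl fun ξ _ => by rw [map_smul, IsLinearMap.mk'_apply]
  rw [this]
  simp only [Finset.sum_apply, Pi.smul_apply, smul_eq_mul, generatorMatrix, Matrix.of_apply]
  exact Finset.sum_congr rfl fun ξ _ => mul_comm _ _

theorem generatorMatrix_sum_row (lam : ℝ) (η : Config (Torus d n)) :
    ∑ ξ, generatorMatrix (generator d n lam) η ξ = 0 := by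
  have := generator_eq_sum lam (fun _ => 1) η
  simp only [mul_one] at this
  rw [← this]
  simp [generator, exclusionGenerator, reactionGenerator]

theorem generatorMatrix_nonneg {lam : ℝ} (hlam : 0 < lam) {η ξ : Config (Torus d n)} (h : η ≠ ξ) :
    0 ≤ generatorMatrix (generator d n lam) η ξ := by
  have hs : ∀ ζ, 0 ≤ (Pi.single ξ 1 : Config (Torus d n) → ℝ) ζ := fun ζ => by
    rw [Pi.single_apply]; split_ifs <;> norm_num
  have h0 : (Pi.single ξ 1 : Config (Torus d n) → ℝ) η = 0 := by simp [h]
  simp only [generatorMatrix, Matrix.of_apply, generator, exclusionGenerator, reactionGenerator, h0,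
    sub_zero]
  refine add_nonneg (mul_nonneg (by positivity) (Finset.sum_nonneg fun x _ =>
    Finset.sum_nonneg fun j _ => hs _)) (Finset.sum_nonneg fun x _ => mul_nonneg ?_ (hs _))
  exact zero_le_one.trans (flipRate_bounds hlam η x).1

theorem flip_ne_self {V : Type*} [DecidableEq V] (η : Config V) (x : V) : flip η x ≠ η := fun h => by
  have := congrFun h x
  simp [flip] at this

theorem generatorMatrix_flip_pos {lam : ℝ} (hlam : 0 < lam) (ξ : Config (Torus d n))
    (x : Torus d n) : 0 < generatorMatrix (generator d n lam) (flip ξ x) ξ := by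
  have hs : ∀ ζ, 0 ≤ (Pi.single ξ 1 : Config (Torus d n) → ℝ) ζ := fun ζ => by
    rw [Pi.single_apply]; split_ifs <;> norm_num
  have h0 : (Pi.single ξ 1 : Config (Torus d n) → ℝ) (flip ξ x) = 0 := by
    simp [flip_ne_self]
  simp only [generatorMatrix, Matrix.of_apply, generator, exclusionGenerator, reactionGenerator, h0,
    sub_zero]
  refine add_pos_of_nonneg_of_pos (mul_nonneg (by positivity) (Finset.sum_nonneg fun x _ =>
    Finset.sum_nonneg fun j _ => hs _)) (Finset.sum_pos' (fun y _ => mul_nonneg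
      (zero_le_one.trans (flipRate_bounds hlam _ y).1) (hs _)) ⟨x, Finset.mem_univ x, ?_⟩)
  rw [flip_flip]
  simpa using zero_lt_one.trans_le (flipRate_bounds hlam (flip ξ x) x).1

/-- A property of configurations that is stable under flips holds everywhere or nowhere. -/
theorem forall_of_flip {V : Type*} [Fintype V] [DecidableEq V] {Q : Config V → Prop}
    (hQ : ∀ η x, Q η → Q (flip η x)) {η : Config V} (h : Q η) (ξ : Config V) : Q ξ := by
  classical
  have : ∀ A : Finset V, Q fun x => if x ∈ A then ξ x else η x := by
    intro A
    induction A using Finset.induction_on with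
    | empty => simpa using h
    | insert a A ha ih =>
      by_cases hc : ξ a = η a
      · convert ih using 2 with x
        by_cases hx : x = a
        · subst hx; simp [ha, hc]
        · simp [hx]
      · convert hQ _ a ih using 1
        ext x
        by_cases hx : x = a
        · subst hx
          simp only [Finset.mem_insert_self, if_true, flip, Function.update_self, ha, if_false]
          revert hc
          cases ξ x <;> cases η x <;> simp
        · simp [flip, hx]
  simpa using this Finset.univ

variable {Ω : Type*} [MeasurableSpace Ω] {P : Measure Ω} [IsProbabilityMeasure P]
  {X : ℝ → Ω → Config (Torus d n)}

/-- Zeros propagate backwards along jumps, and flips have rate at least 1 and connect all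
configurations; one zero would force total mass zero. -/
theorem lawAt_pos {lam : ℝ} (hlam : 0 < lam) (hX : IsMarkovProcess (generator d n lam) P X)
    {t : ℝ} (ht : 0 < t) (ξ : Config (Torus d n)) : 0 < lawAt (generator d n lam) P X t ξ := by
  refine lt_of_le_of_ne (hX.lawAt_nonneg ht.le ξ) fun h => ?_
  have hall : ∀ η, lawAt (generator d n lam) P X t η = 0 :=
    forall_of_flip (Q := fun η => lawAt (generator d n lam) P X t η = 0)
      (fun η x hη => hX.lawAt_eq_zero_of_rate_pos (fun _ _ => generatorMatrix_nonneg hlam) ht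
        (generatorMatrix_flip_pos hlam η x) hη) h.symm
  have := hX.sum_lawAt ht.le
  simp [hall] at this

theorem bernoulliProduct_real_singleton {V : Type*} [Fintype V] (m : unitInterval) (η : Config V) :
    (bernoulliProduct V m).real {η} = bweight (m : ℝ) η := by
  have := bernoulliProduct_real_cylinder m (Finset.univ : Finset V) η
  have e : {ξ : Config V | ∀ x ∈ Finset.univ, ξ x = η x} = {η} := by
    ext ξ; simp [funext_iff]
  rwa [e] at this

/-- The density of the law at time `t` with respect to the Bernoulli product measure. -/
def densityAt (lam : ℝ) (P : Measure Ω) (X : ℝ → Ω → Config (Torus d n)) (r t : ℝ)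
    (η : Config (Torus d n)) : ℝ :=
  lawAt (generator d n lam) P X t η / bweight r η

variable {lam : ℝ} {ρ : unitInterval}

theorem entropyAt_eq (hX : IsMarkovProcess (generator d n lam) P X) {t : ℝ} (ht : 0 ≤ t) :
    entropyAt P X ρ t = dentropy (ρ : ℝ) (densityAt lam P X ρ t) := by
  unfold entropyAt relEntropy dentropy bexp densityAt
  refine Finset.sum_congr rfl fun η _ => ?_
  rw [hX.real_eq_lawAt ht, bernoulliProduct_real_singleton]
  ring

theorem densityAt_pos (hlam : 0 < lam) (h0 : 0 < (ρ : ℝ)) (h1 : (ρ : ℝ) < 1)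
    (hX : IsMarkovProcess (generator d n lam) P X) {t : ℝ} (ht : 0 < t) (η : Config (Torus d n)) :
    0 < densityAt lam P X ρ t η :=
  div_pos (lawAt_pos hlam hX ht η) (bweight_pos h0 h1 η)

theorem bexp_densityAt (h0 : 0 < (ρ : ℝ)) (h1 : (ρ : ℝ) < 1)
    (hX : IsMarkovProcess (generator d n lam) P X) {t : ℝ} (ht : 0 ≤ t) :
    bexp (ρ : ℝ) (densityAt lam P X ρ t) = 1 := by
  rw [← hX.sum_lawAt ht]
  exact Finset.sum_congr rfl fun η _ => mul_div_cancel₀ _ (bweight_pos h0 h1 η).ne'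

/-- Since x log x is continuous at 0, this includes t = 0, where the law may vanish at some
configurations. -/
theorem continuousOn_entropyAt (hX : IsMarkovProcess (generator d n lam) P X) :
    ContinuousOn (entropyAt P X ρ) (Set.Ici 0) := by
  have : Continuous fun t => dentropy (ρ : ℝ) (densityAt lam P X ρ t) := by
    unfold dentropy bexp
    refine continuous_finsetSum _ fun η _ => continuous_const.mul ?_
    refine Real.continuous_mul_log.comp (Continuous.div_const ?_ _)
    exact continuous_iff_continuousAt.2 fun t => (hasDerivAt_lawAt _ P X η t).continuousAt
  exact this.continuousOn.congr fun t ht => entropyAt_eq hX ht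

/-- The entropy production identity. -/
theorem hasDerivAt_entropyAt (hlam : 0 < lam) (h0 : 0 < (ρ : ℝ)) (h1 : (ρ : ℝ) < 1)
    (hX : IsMarkovProcess (generator d n lam) P X) {t : ℝ} (ht : 0 < t) :
    HasDerivAt (entropyAt P X ρ)
      (bexp (ρ : ℝ) fun η => densityAt lam P X ρ t η *
        generator d n lam (fun ξ => Real.log (densityAt lam P X ρ t ξ)) η) t := by
  set f := densityAt lam P X ρ t with hf
  set u := lawAt (generator d n lam) P X with hu
  set G := generatorMatrix (generator d n lam) with hG
  have hd : HasDerivAt (fun t => dentropy (ρ : ℝ) (densityAt lam P X ρ t))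
      (∑ η, (∑ ξ, u t ξ * G ξ η) * (Real.log (f η) + 1)) t := by
    unfold dentropy bexp
    refine HasDerivAt.fun_sum fun η _ => ?_
    have hw := (bweight_pos h0 h1 η).ne'
    have a : HasDerivAt (fun t => densityAt lam P X ρ t η)
        ((∑ ξ, u t ξ * G ξ η) / bweight ρ η) t := (hasDerivAt_lawAt _ P X η t).div_const _
    have hpos := densityAt_pos hlam h0 h1 hX ht η
    have b := ((Real.hasDerivAt_mul_log hpos.ne').comp t a).const_mul (bweight (ρ : ℝ) η)
    refine b.congr_deriv ?_
    rw [← hf]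
    field_simp
  have he : HasDerivAt (entropyAt P X ρ)
      (∑ η, (∑ ξ, u t ξ * G ξ η) * (Real.log (f η) + 1)) t := by
    refine hd.congr_of_eventuallyEq ?_
    filter_upwards [lt_mem_nhds ht] with s hs using entropyAt_eq hX hs.le
  refine he.congr_deriv ?_
  -- The +1 from differentiating x log x disappears because the rows of the generator matrix sum to
  -- zero.
  calc ∑ η, (∑ ξ, u t ξ * G ξ η) * (Real.log (f η) + 1) =
        ∑ ξ, u t ξ * (∑ η, G ξ η * Real.log (f η) + ∑ η, G ξ η) := by
        simp only [Finset.sum_mul, Finset.mul_sum, mul_add, Finset.sum_add_distrib, mul_one]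
        congr 1
        · rw [Finset.sum_comm]
          simp only [mul_assoc]
        · rw [Finset.sum_comm]
    _ = _ := by
        refine Finset.sum_congr rfl fun ξ _ => ?_
        rw [generatorMatrix_sum_row, add_zero, ← generator_eq_sum, ← mul_assoc]
        congr 1
        rw [hf, densityAt, mul_div_cancel₀ _ (bweight_pos h0 h1 ξ).ne']

end Generator

end ReactionDiffusion

end

/-! ### Conclusion by Grönwall's inequality -/

theorem theorem2p1 (d : ℕ) (hd : 1 ≤ d) (lam : ℝ) (hlam : 0 < lam)
    (ρ : unitInterval) (hρ0 : 0 < (ρ : ℝ)) (hρ1 : (ρ : ℝ) < 1)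
    (hF : ReactionDiffusion.forcing d lam ρ = 0) (T : ℝ) (hT : 0 < T) (K : ℝ) (hK : 0 ≤ K) :
    ∃ C : ℝ, 0 < C ∧
      ∀ (n : ℕ) [NeZero n], (d = 2 → n ≠ 1) →
      ∀ (Ω : Type*) [MeasurableSpace Ω] (P : MeasureTheory.Measure Ω)
        [MeasureTheory.IsProbabilityMeasure P]
        (X : ℝ → Ω → ReactionDiffusion.Config (ReactionDiffusion.Torus d n)),
        ReactionDiffusion.IsMarkovProcess (ReactionDiffusion.generator d n lam) P X →
        (ReactionDiffusion.entropyAt P X ρ 0 ≤ K * ReactionDiffusion.entropyScale d n →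
          ∀ t ∈ Set.Ioc 0 T,
            DifferentiableAt ℝ (ReactionDiffusion.entropyAt P X ρ) t ∧
            deriv (ReactionDiffusion.entropyAt P X ρ) t
              ≤ C * ReactionDiffusion.entropyScale d n) ∧
        (P.map (X 0) = ReactionDiffusion.bernoulliProduct (ReactionDiffusion.Torus d n) ρ →
          ∀ t ∈ Set.Icc 0 T,
            ReactionDiffusion.entropyAt P X ρ t
              ≤ C * t * ReactionDiffusion.entropyScale d n) := by
  open ReactionDiffusion in
  rw [forcing_eq] at hF
  obtain ⟨C₀, hC₀, hprod⟩ := exists_entropyProduction_le hd hlam hρ0 hρ1 hF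
  -- Grönwall gives H + S ≤ exp (C₀ T) (K + 1) S up to time T, which is inserted back into H' ≤ C₀
  -- (H + S).
  refine ⟨C₀ * (Real.exp (C₀ * T) * (K + 1)), by positivity, fun n _ hn2 Ω _ P _ X hX => ?_⟩
  set S := entropyScale d n with hS
  have hS0 : 0 < S := by linarith [half_le_entropyScale hd n hn2]
  set H := entropyAt P X ρ with hH
  have hcont : ContinuousOn H (Set.Ici 0) := continuousOn_entropyAt hX
  have hderiv : ∀ t, 0 < t → DifferentiableAt ℝ H t ∧ deriv H t ≤ C₀ * (H t + S) := by
    intro t ht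
    have h := hasDerivAt_entropyAt hlam hρ0 hρ1 hX ht
    refine ⟨h.differentiableAt, ?_⟩
    rw [h.deriv, hH, entropyAt_eq hX ht.le]
    exact hprod n hn2 _ (densityAt_pos hlam hρ0 hρ1 hX ht) (bexp_densityAt hρ0 hρ1 hX ht.le)
  have hgron : ∀ t, 0 ≤ t → H t + S ≤ Real.exp (C₀ * t) * (H 0 + S) := by
    have hanti : AntitoneOn (fun t => Real.exp (-(C₀ * t)) * (H t + S)) (Set.Ici 0) := by
      refine antitoneOn_of_deriv_nonpos (convex_Ici 0) ?_ ?_ ?_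
      · exact (by fun_prop : Continuous fun t : ℝ => Real.exp (-(C₀ * t))).continuousOn.mul
          (hcont.add continuousOn_const)
      · intro t ht
        rw [interior_Ici] at ht
        have := (hderiv t ht).1
        exact DifferentiableAt.differentiableWithinAt (by fun_prop)
      · intro t ht
        rw [interior_Ici] at ht
        obtain ⟨h1, h2⟩ := hderiv t ht
        have he : HasDerivAt (fun t : ℝ => Real.exp (-(C₀ * t)))
            (Real.exp (-(C₀ * t)) * -(C₀ * 1)) t :=
          (((hasDerivAt_id t).const_mul C₀).neg).exp
        rw [(he.fun_mul (h1.hasDerivAt.add_const S)).deriv]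
        have := mul_le_mul_of_nonneg_left h2 (Real.exp_pos (-(C₀ * t))).le
        linarith
    intro t ht
    have := hanti (Set.mem_Ici.2 le_rfl) (Set.mem_Ici.2 ht) ht
    simp only [mul_zero, neg_zero, Real.exp_zero, one_mul] at this
    calc H t + S = Real.exp (C₀ * t) * (Real.exp (-(C₀ * t)) * (H t + S)) := by
          rw [← mul_assoc, ← Real.exp_add]; simp
      _ ≤ _ := by gcongr
  have hbound : H 0 ≤ K * S → ∀ t ∈ Set.Ioc 0 T, DifferentiableAt ℝ H t ∧
      deriv H t ≤ C₀ * (Real.exp (C₀ * T) * (K + 1)) * S := by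
    intro hK0 t ht
    obtain ⟨h1, h2⟩ := hderiv t ht.1
    refine ⟨h1, h2.trans ?_⟩
    rw [mul_assoc, mul_assoc]
    gcongr
    calc H t + S ≤ Real.exp (C₀ * t) * (H 0 + S) := hgron t ht.1.le
      _ ≤ Real.exp (C₀ * t) * ((K + 1) * S) := by gcongr; linarith
      _ ≤ _ := by gcongr; exact ht.2
  refine ⟨hbound, fun hinit t ht => ?_⟩
  have hH0 : H 0 = 0 := by
    rw [hH]
    unfold entropyAt relEntropy
    rw [hinit]
    refine Finset.sum_eq_zero fun η _ => ?_
    rw [bernoulliProduct_real_singleton, div_self (bweight_pos hρ0 hρ1 η).ne']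
    simp
  rcases ht.1.eq_or_lt with h | h
  · rw [← h, hH0]; simp
  have hb := hbound (by rw [hH0]; positivity)
  -- Mean value inequality on [0, t]: continuity at 0 suffices, the derivative being needed only in
  -- the interior.
  have := Convex.image_sub_le_mul_sub_of_deriv_le (convex_Icc 0 t)
    (hcont.mono Set.Icc_subset_Ici_self)
    (fun s hs => by
      rw [interior_Icc] at hs
      exact (hderiv s hs.1).1.differentiableWithinAt)
    (fun s hs => by
      rw [interior_Icc] at hs
      exact (hb s ⟨hs.1, hs.2.le.trans ht.2⟩).2)
    0 (Set.left_mem_Icc.2 h.le) t (Set.right_mem_Icc.2 h.le) h.le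
  rw [hH0] at this
  linarith
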